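/- Let $N\in\{1,2,3\}$, let $m$ be a natural number, and let $\Omega\subset\mathbb{R}^N$ be a bounded domain (a nonempty, bounded, connected open set; no regularity of $\partial\Omega$ is required). Let $\varepsilon_1,\dots,\varepsilon_m>0$, and let $H=H_0^1(\Omega,\mathbb{R}^m)$, where $H_0^1(\Omega)$ is the closure of $C_c^\infty(\Omega)$ in $H^1(\Omega)$, be equipped with the inner product $$(\mathbf u,\mathbf v)_H=\int_\Omega\sum_{i=1}^m\varepsilon_i\nabla u_i\cdot\nabla v_i\,d\mathbf x,\qquad \|\mathbf u\|_H=\sqrt{(\mathbf u,\mathbf u)_H},$$ which makes $H$ a Hilbert space. Assume that - $\mathbf g=(g_{ij})\in\mathbb{R}^{m\times m}$ is symmetric, and either $g_{ij}>0$ for all $i,j$, or $\mathbf g$ is positive definite; - $a_i\in L^\infty(\Omega)$ and $a_i(\mathbf x)>-\lambda_1$ for a.e. $\mathbf x\in\Omega$, for each $i=1,\dots,m$, where $\lambda_1>0$ is the first Dirichlet eigenvalue of $-\Delta$ in $\Omega$. Define $E:H\to\mathbb{R}$ by $$E(\mathbf u)=\frac12\int_\Omega\sum_{i=1}^m\left(\varepsilon_i|\nabla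 u_i|^2+a_i|u_i|^2\right)d\mathbf x-\frac14\int_\Omega\sum_{i,j=1}^m g_{ij}|u_i|^2|u_j|^2\,d\mathbf x,$$ let $E'(\mathbf u)$ denote its Fréchet derivative, and set $$G(\mathbf u)=\langle E'(\mathbf u),\mathbf u\rangle,\qquad \mathcal N=\{\mathbf u\in H\setminus\{0\}: G(\mathbf u)=0\},\qquad T_{\mathbf u}\mathcal N=\{\boldsymbol\xi\in H:\langle G'(\mathbf u),\boldsymbol\xi\rangle=0\}\quad(\mathbf u\in\mathcal N).$$ For $\mathbf u\in\mathcal N$ let the Riemannian gradient $\nabla_{\mathcal N}E(\mathbf u)$ be the unique element of $T_{\mathbf u}\mathcal N$ such that $(\nabla_{\mathcal N}E(\mathbf u),\boldsymbol\xi)_H=\langle E'(\mathbf u),\boldsymbol\xi\rangle$ for all $\boldsymbol\xi\in T_{\mathbf u}\mathcal N$. Then $E$ satisfies the Palais–Smale condition on $\mathcal N$: every sequence $\{\mathbf u_n\}\subset\mathcal N$ such that $\{E(\mathbf u_n)\}$ is bounded and $\|\nabla_{\mathcal N}E(\mathbf u_n)\|_H\to0$ as $n\to\infty$ has a subsequence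 that converges in $H$. -/

import Mathlib

open MeasureTheory Filter Topology Set
open scoped ENNReal Distributions InnerProductSpace Gradient

noncomputable section

/-- A bounded domain in `ℝᴺ`: a nonempty, connected, bounded open set. -/
structure BoundedDomain (N : ℕ) extends TopologicalSpace.Opens (EuclideanSpace ℝ (Fin N)) where
  isConnected : IsConnected carrier
  isBounded : Bornology.IsBounded carrier

namespace BoundedDomain

variable {N : ℕ}

/-- Lebesgue measure on `Ω`. -/
abbrev measure (Ω : BoundedDomain N) : Measure (EuclideanSpace ℝ (Fin N)) :=
  volume.restrict Ω.carrier

/-- `L²(Ω) × L²(Ω; ℝᴺ)`. A function of `H¹(Ω)` is represented by the pair of the function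
and its weak gradient. -/
abbrev L2Pair (Ω : BoundedDomain N) : Type :=
  Lp ℝ 2 Ω.measure × Lp (EuclideanSpace ℝ (Fin N)) 2 Ω.measure

/-- The pairs `(φ, ∇φ)` with `φ ∈ C_c^∞(Ω)`. -/
def testPairs (Ω : BoundedDomain N) : Submodule ℝ Ω.L2Pair where
  carrier := {p | ∃ φ : 𝓓(Ω.toOpens, ℝ), p.1 =ᵐ[Ω.measure] φ ∧ p.2 =ᵐ[Ω.measure] ∇ φ}
  zero_mem' := by
    refine ⟨0, Lp.coeFn_zero _ _ _, (Lp.coeFn_zero _ _ _).trans (.of_forall fun x => ?_)⟩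
    have : ((0 : 𝓓(Ω.toOpens, ℝ)) : EuclideanSpace ℝ (Fin N) → ℝ) = fun _ => 0 := rfl
    rw [this, gradient_fun_const]
    rfl
  add_mem' := by
    rintro p q ⟨φ, h1, h2⟩ ⟨ψ, h3, h4⟩
    refine ⟨φ + ψ, ?_, ?_⟩
    · filter_upwards [Lp.coeFn_add p.1 q.1, h1, h3] with x hx h1 h3
      rw [Prod.fst_add, hx, Pi.add_apply, h1, h3]; rfl
    · filter_upwards [Lp.coeFn_add p.2 q.2, h2, h4] with x hx h2 h4
      rw [Prod.snd_add, hx, Pi.add_apply, h2, h4]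
      have hφ : DifferentiableAt ℝ φ x := (φ.contDiff.differentiable (by simp)) x
      have hψ : DifferentiableAt ℝ ψ x := (ψ.contDiff.differentiable (by simp)) x
      have : ((φ + ψ : 𝓓(Ω.toOpens, ℝ)) : EuclideanSpace ℝ (Fin N) → ℝ) = ⇑φ + ⇑ψ := rfl
      rw [gradient, gradient, gradient, this, fderiv_add hφ hψ, map_add]
  smul_mem' := by
    rintro c p ⟨φ, h1, h2⟩
    refine ⟨c • φ, ?_, ?_⟩
    · filter_upwards [Lp.coeFn_smul c p.1, h1] with x hx h1
      rw [Prod.smul_fst, hx, Pi.smul_apply, h1]; rfl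
    · filter_upwards [Lp.coeFn_smul c p.2, h2] with x hx h2
      rw [Prod.smul_snd, hx, Pi.smul_apply, h2]
      have hφ : DifferentiableAt ℝ φ x := (φ.contDiff.differentiable (by simp)) x
      have : ((c • φ : 𝓓(Ω.toOpens, ℝ)) : EuclideanSpace ℝ (Fin N) → ℝ) = c • ⇑φ := rfl
      rw [gradient, gradient, this, fderiv_const_smul hφ, map_smulₛₗ]
      simp

/-- `H₀¹(Ω)`: the closure of `C_c^∞(Ω)` in the `H¹` topology, each element being represented by
the pair `(u, ∇u)` of its class in `L²(Ω)` and its weak gradient in `L²(Ω; ℝᴺ)`. -/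
def H01 (Ω : BoundedDomain N) : Submodule ℝ Ω.L2Pair := Ω.testPairs.topologicalClosure

/-- The function underlying an element of `H₀¹(Ω)`. -/
abbrev H01.val {Ω : BoundedDomain N} (u : Ω.H01) : Lp ℝ 2 Ω.measure := u.1.1

/-- The weak gradient of an element of `H₀¹(Ω)`. -/
abbrev H01.grad {Ω : BoundedDomain N} (u : Ω.H01) :
    Lp (EuclideanSpace ℝ (Fin N)) 2 Ω.measure := u.1.2

/-- `lam` is an eigenvalue of `-Δ` on `Ω` with homogeneous Dirichlet boundary condition (in the
weak sense). -/
def IsDirichletEigenvalue (Ω : BoundedDomain N) (lam : ℝ) : Prop :=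
  ∃ u : Ω.H01, u ≠ 0 ∧ ∀ v : Ω.H01,
    ∫ x, inner ℝ (H01.grad u x) (H01.grad v x) ∂Ω.measure =
      lam * ∫ x, H01.val u x * H01.val v x ∂Ω.measure

/-- The first Dirichlet eigenvalue `λ₁` of `-Δ` on `Ω`. -/
def firstDirichletEigenvalue (Ω : BoundedDomain N) : ℝ :=
  sInf {lam | Ω.IsDirichletEigenvalue lam}

/-- Poincaré inequality for compactly supported `C¹` functions. -/
theorem poincare_test [NeZero N] {R : ℝ} (φ : EuclideanSpace ℝ (Fin N) → ℝ)
    (hcd : ContDiff ℝ 1 φ) (hsupp : HasCompactSupport φ) (hR : ∀ x, φ x ≠ 0 → ‖x‖ ≤ R) :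
    ∫ x, φ x ^ 2 ≤ 4 * R ^ 2 * ∫ x, ‖∇ φ x‖ ^ 2 := by
  have hd : Differentiable ℝ φ := hcd.differentiable (by simp)
  have hc : Continuous φ := hcd.continuous
  have hcf : Continuous (fderiv ℝ φ) := hcd.continuous_fderiv (by simp)
  have hcg : Continuous (∇ φ) := (InnerProductSpace.toDual ℝ _).symm.continuous.comp hcf
  have hsg : HasCompactSupport (∇ φ) :=
    (hsupp.fderiv ℝ).comp_left (g := (InnerProductSpace.toDual ℝ _).symm) (map_zero _)
  obtain ⟨e, hne⟩ : ∃ e : EuclideanSpace ℝ (Fin N), ‖e‖ = 1 :=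
    ⟨EuclideanSpace.single 0 1, by simp⟩
  obtain ⟨L, hL⟩ : ∃ L : EuclideanSpace ℝ (Fin N) →L[ℝ] ℝ, ∀ x, L x = inner ℝ e x :=
    ⟨innerSL ℝ e, fun x => rfl⟩
  have hLe : L e = 1 := by rw [hL, real_inner_self_eq_norm_sq, hne]; norm_num
  have hfsq : ∀ x, fderiv ℝ (fun y => φ y ^ 2) x e = 2 * φ x * inner ℝ (∇ φ x) e := by
    intro x
    have h := ((hd x).hasFDerivAt.pow 2).fderiv
    rw [h, inner_gradient_left]
    simp [mul_assoc]
  have hcs2 : HasCompactSupport (fun x => φ x ^ 2) :=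
    hsupp.comp_left (g := fun t : ℝ => t ^ 2) (by simp)
  have hparts : ∫ x, φ x ^ 2 * fderiv ℝ L x e
      = - ∫ x, fderiv ℝ (fun y => φ y ^ 2) x e * L x := by
    apply integral_mul_fderiv_eq_neg_fderiv_mul_of_integrable
    · apply Continuous.integrable_of_hasCompactSupport
      · simp only [hfsq]; fun_prop
      · refine HasCompactSupport.mul_right ?_
        simp only [hfsq]
        exact HasCompactSupport.mul_right (hsupp.mul_left (f := fun _ => (2 : ℝ)))
    · simp only [ContinuousLinearMap.fderiv, hLe, mul_one]
      exact (hc.pow 2).integrable_of_hasCompactSupport hcs2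
    · exact ((hc.pow 2).mul L.continuous).integrable_of_hasCompactSupport hcs2.mul_right
    · exact fun x _ => (hd x).pow 2
    · exact fun x _ => L.differentiableAt
  simp only [ContinuousLinearMap.fderiv, hLe, mul_one, hfsq] at hparts
  have hi1 : Integrable fun x => φ x ^ 2 :=
    (hc.pow 2).integrable_of_hasCompactSupport hcs2
  have hsg2 : HasCompactSupport fun x => ‖∇ φ x‖ ^ 2 :=
    hsg.comp_left (g := fun v : EuclideanSpace ℝ (Fin N) => ‖v‖ ^ 2) (by simp)
  have hcg2 : Continuous fun x => ‖∇ φ x‖ ^ 2 := by fun_prop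
  have hi2 : Integrable fun x => ‖∇ φ x‖ ^ 2 := hcg2.integrable_of_hasCompactSupport hsg2
  have hbound : ∫ x, φ x ^ 2 ≤ ∫ x, (φ x ^ 2 / 2 + 2 * R ^ 2 * ‖∇ φ x‖ ^ 2) := by
    rw [hparts, ← integral_neg]
    refine integral_mono ?_ ((hi1.div_const 2).add (hi2.const_mul _)) fun x => ?_
    · refine (Continuous.integrable_of_hasCompactSupport (by fun_prop) ?_).neg
      exact ((hsupp.mul_left (f := fun _ => (2 : ℝ))).mul_right).mul_right
    · dsimp only
      by_cases hx : φ x = 0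
      · simp only [hx]; simp; positivity
      · have hxR : ‖x‖ ≤ R := hR x hx
        have hR0 : 0 ≤ R := (norm_nonneg x).trans hxR
        have h1 : |inner ℝ (∇ φ x) e| ≤ ‖∇ φ x‖ := by
          simpa [hne] using abs_real_inner_le_norm (∇ φ x) e
        have h2 : |L x| ≤ R := by
          rw [hL]
          refine (abs_real_inner_le_norm e x).trans ?_
          simpa [hne] using hxR
        have h3 : -(2 * φ x * inner ℝ (∇ φ x) e * L x) ≤ 2 * |φ x| * (‖∇ φ x‖ * R) := by
          refine (neg_le_abs _).trans ?_
          rw [mul_assoc, abs_mul, abs_mul, abs_mul, abs_two]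
          gcongr
        refine h3.trans ?_
        nlinarith [sq_nonneg (|φ x| - 2 * (‖∇ φ x‖ * R)), sq_abs (φ x)]
  rw [integral_add (hi1.div_const 2) (hi2.const_mul _), integral_div, integral_const_mul] at hbound
  linarith

/-- Poincaré inequality in `H₀¹(Ω)`. -/
theorem exists_poincare [NeZero N] (Ω : BoundedDomain N) :
    ∃ C : ℝ, 0 ≤ C ∧ ∀ u : Ω.H01, ‖H01.val u‖ ≤ C * ‖H01.grad u‖ := by
  obtain ⟨R, hR0, hR⟩ := Ω.isBounded.exists_pos_norm_le
  refine ⟨2 * R, by positivity, fun u => ?_⟩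
  have hclosed : IsClosed {p : Ω.L2Pair | ‖p.1‖ ≤ 2 * R * ‖p.2‖} :=
    isClosed_le (by fun_prop) (by fun_prop)
  have hsub : (Ω.testPairs : Set Ω.L2Pair) ⊆ {p : Ω.L2Pair | ‖p.1‖ ≤ 2 * R * ‖p.2‖} := by
    rintro p ⟨φ, h1, h2⟩
    have hz : ∀ x ∉ Ω.carrier, x ∉ tsupport φ := fun x hx h => hx (φ.tsupport_subset h)
    have e1 : ‖p.1‖ ^ 2 = ∫ x, φ x ^ 2 := by
      have h0 : ∫ x in Ω.carrier, φ x ^ 2 = ∫ x, φ x ^ 2 :=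
        setIntegral_eq_integral_of_forall_compl_eq_zero fun x hx => by
          rw [image_eq_zero_of_notMem_tsupport (hz x hx)]; simp
      rw [← real_inner_self_eq_norm_sq, L2.inner_def, ← h0]
      refine integral_congr_ae ?_
      filter_upwards [h1] with x hx
      rw [hx, real_inner_self_eq_norm_sq, Real.norm_eq_abs, sq_abs]
    have e2 : ‖p.2‖ ^ 2 = ∫ x, ‖∇ φ x‖ ^ 2 := by
      have h0 : ∫ x in Ω.carrier, ‖∇ φ x‖ ^ 2 = ∫ x, ‖∇ φ x‖ ^ 2 :=
        setIntegral_eq_integral_of_forall_compl_eq_zero fun x hx => by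
          have : fderiv ℝ (φ : EuclideanSpace ℝ (Fin N) → ℝ) x = 0 := by
            refine image_eq_zero_of_notMem_tsupport
              (f := fderiv ℝ (φ : EuclideanSpace ℝ (Fin N) → ℝ)) fun h => hz x hx ?_
            exact (tsupport_fderiv_subset ℝ (f := ⇑φ)) h
          simp only [gradient, this, map_zero, norm_zero]; norm_num
      rw [← real_inner_self_eq_norm_sq, L2.inner_def, ← h0]
      refine integral_congr_ae ?_
      filter_upwards [h2] with x hx
      rw [hx, real_inner_self_eq_norm_sq]
    have := poincare_test φ (φ.contDiff.of_le (by simp)) φ.hasCompactSupport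
      fun x hx => hR x (φ.tsupport_subset (subset_tsupport _ hx))
    rw [← e1, ← e2] at this
    change ‖p.1‖ ≤ 2 * R * ‖p.2‖
    refine (abs_le_of_sq_le_sq' (this.trans_eq ?_) (by positivity)).2
    ring
  exact closure_minimal hsub hclosed u.2

end BoundedDomain

open BoundedDomain

variable {N m : ℕ}

/-- The Sobolev space `H = H₀¹(Ω; ℝᵐ)`, to be equipped with the inner product
`(u, v)_H = ∫_Ω ∑ᵢ εᵢ ∇uᵢ · ∇vᵢ`, where `εᵢ > 0`. -/
def SystemSpace (Ω : BoundedDomain N) (_ε : Fin m → Ioi (0 : ℝ)) : Type :=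
  Fin m → Ω.H01

namespace SystemSpace

variable {Ω : BoundedDomain N} {ε : Fin m → Ioi (0 : ℝ)}

instance : AddCommGroup (SystemSpace Ω ε) := inferInstanceAs (AddCommGroup (Fin m → Ω.H01))

instance : Module ℝ (SystemSpace Ω ε) := inferInstanceAs (Module ℝ (Fin m → Ω.H01))

/-- The `i`-th component `uᵢ` of `u`. -/
def comp (u : SystemSpace Ω ε) (i : Fin m) : Lp ℝ 2 Ω.measure := H01.val (u i)

/-- The weak gradient `∇uᵢ` of the `i`-th component of `u`. -/
def grad (u : SystemSpace Ω ε) (i : Fin m) : Lp (EuclideanSpace ℝ (Fin N)) 2 Ω.measure :=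
  H01.grad (u i)

/-- The inner product `(u, v)_H = ∫_Ω ∑ᵢ εᵢ ∇uᵢ · ∇vᵢ`. -/
def innerH (u v : SystemSpace Ω ε) : ℝ :=
  ∫ x, ∑ i, (ε i : ℝ) * inner ℝ (u.grad i x) (v.grad i x) ∂Ω.measure

theorem innerH_eq_sum (u v : SystemSpace Ω ε) :
    innerH u v = ∑ i, (ε i : ℝ) * inner ℝ (u.grad i) (v.grad i) := by
  rw [innerH, integral_finsetSum _ fun i _ => (L2.integrable_inner _ _).const_mul _]
  simp only [integral_const_mul, L2.inner_def]

/-- `(·, ·)_H` is an inner product; it is definite by the Poincaré inequality. -/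
@[reducible] def innerCore [NeZero N] : InnerProductSpace.Core ℝ (SystemSpace Ω ε) where
  inner := innerH
  conj_inner_symm u v := by
    simp only [innerH_eq_sum, conj_trivial]
    exact Finset.sum_congr rfl fun i _ => by rw [real_inner_comm]
  re_inner_nonneg u := by
    simp only [innerH_eq_sum, RCLike.re_to_real]
    exact Finset.sum_nonneg fun i _ => mul_nonneg (ε i).2.le real_inner_self_nonneg
  add_left u v w := by
    simp only [innerH_eq_sum, ← Finset.sum_add_distrib, ← mul_add, ← inner_add_left]
    rfl
  smul_left u v r := by
    have : ∀ i, (r • u).grad i = r • u.grad i := fun i => rfl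
    simp only [innerH_eq_sum, Finset.mul_sum, this, real_inner_smul_left, conj_trivial]
    exact Finset.sum_congr rfl fun i _ => by ring
  definite u hu := by
    obtain ⟨C, -, hC⟩ := exists_poincare Ω
    rw [innerH_eq_sum, Finset.sum_eq_zero_iff_of_nonneg
      fun i _ => mul_nonneg (ε i).2.le real_inner_self_nonneg] at hu
    funext i
    have hg : H01.grad (u i) = 0 := by
      have := (mul_eq_zero.1 (hu i (Finset.mem_univ i))).resolve_left (ne_of_gt (ε i).2)
      exact inner_self_eq_zero.1 this
    have hv : H01.val (u i) = 0 := by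
      have := hC (u i)
      rw [hg, norm_zero, mul_zero] at this
      exact norm_le_zero_iff.1 this
    exact Subtype.ext (Prod.ext hv hg)

instance [NeZero N] : NormedAddCommGroup (SystemSpace Ω ε) :=
  InnerProductSpace.Core.toNormedAddCommGroup (cd := innerCore)

instance [NeZero N] : InnerProductSpace ℝ (SystemSpace Ω ε) :=
  InnerProductSpace.ofCore innerCore.toCore

theorem inner_def [NeZero N] (u v : SystemSpace Ω ε) :
    inner ℝ u v = ∫ x, ∑ i, (ε i : ℝ) * inner ℝ (u.grad i x) (v.grad i x) ∂Ω.measure := rfl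

theorem norm_sq_eq [NeZero N] (u : SystemSpace Ω ε) :
    ‖u‖ ^ 2 = ∑ i, (ε i : ℝ) * ‖u.grad i‖ ^ 2 := by
  rw [← real_inner_self_eq_norm_sq, inner_def, ← innerH, innerH_eq_sum]
  simp only [real_inner_self_eq_norm_sq]

/-- The `H`-norm is equivalent to the product of the `H¹` norms. -/
theorem exists_equiv_prod [NeZero N] (Ω : BoundedDomain N) (ε : Fin m → Ioi (0 : ℝ)) :
    ∃ e : SystemSpace Ω ε ≃L[ℝ] (Fin m → Ω.H01), ∀ u i, e u i = u i := by
  let e : SystemSpace Ω ε ≃ₗ[ℝ] (Fin m → Ω.H01) := LinearEquiv.refl ℝ _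
  obtain ⟨C, hC0, hC⟩ := exists_poincare Ω
  set S : ℝ := ∑ i, (√(ε i : ℝ))⁻¹ with hS
  set T : ℝ := ∑ i, (ε i : ℝ) with hT
  have hS0 : 0 ≤ S := Finset.sum_nonneg fun i _ => by positivity
  have hgrad : ∀ (u : SystemSpace Ω ε) i, ‖u.grad i‖ ≤ S * ‖u‖ := by
    intro u i
    have hpos : 0 < √(ε i : ℝ) := Real.sqrt_pos.2 (ε i).2
    have h1 : (√(ε i : ℝ) * ‖u.grad i‖) ^ 2 ≤ ‖u‖ ^ 2 := by
      rw [norm_sq_eq, mul_pow, Real.sq_sqrt (ε i).2.le]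
      exact Finset.single_le_sum (f := fun i => (ε i : ℝ) * ‖u.grad i‖ ^ 2)
        (fun i _ => mul_nonneg (ε i).2.le (sq_nonneg _)) (Finset.mem_univ i)
    have h2 : √(ε i : ℝ) * ‖u.grad i‖ ≤ ‖u‖ :=
      (abs_le_of_sq_le_sq' h1 (norm_nonneg _)).2
    have h3 : (√(ε i : ℝ))⁻¹ ≤ S :=
      Finset.single_le_sum (f := fun i => (√(ε i : ℝ))⁻¹) (fun i _ => by positivity)
        (Finset.mem_univ i)
    calc ‖u.grad i‖ = (√(ε i : ℝ))⁻¹ * (√(ε i : ℝ) * ‖u.grad i‖) := by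
          field_simp
      _ ≤ S * ‖u‖ := by gcongr
  refine ⟨e.toContinuousLinearEquivOfBounds (max C 1 * S) (√T) (fun u => ?_) (fun u => ?_),
    fun u i => rfl⟩
  · refine (pi_norm_le_iff_of_nonneg (by positivity)).2 fun i => ?_
    have h1 := hgrad u i
    have h2 := hC (u i)
    change max ‖H01.val (u i)‖ ‖H01.grad (u i)‖ ≤ _
    change ‖H01.grad (u i)‖ ≤ _ at h1
    have h4 : 0 ≤ ‖H01.grad (u i)‖ := norm_nonneg _
    have h5 : max C 1 * ‖H01.grad (u i)‖ ≤ max C 1 * S * ‖u‖ := by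
      rw [mul_assoc]; gcongr
    refine max_le ((h2.trans ?_).trans h5) (le_trans ?_ h5)
    · gcongr; exact le_max_left _ _
    · exact le_mul_of_one_le_left h4 (le_max_right _ _)
  · have hT0 : 0 ≤ T := Finset.sum_nonneg fun i _ => (ε i).2.le
    refine (abs_le_of_sq_le_sq' ?_ (by positivity)).2
    rw [norm_sq_eq, mul_pow, Real.sq_sqrt hT0, hT, Finset.sum_mul]
    refine Finset.sum_le_sum fun i _ => mul_le_mul_of_nonneg_left ?_ (ε i).2.le
    have h1 : ‖H01.grad (u i)‖ ≤ ‖u i‖ := le_max_right ‖(u i).1.1‖ ‖(u i).1.2‖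
    have h2 := h1.trans (norm_le_pi_norm u i)
    change ‖H01.grad (u i)‖ ^ 2 ≤ _
    gcongr

instance [NeZero N] : CompleteSpace (SystemSpace Ω ε) := by
  obtain ⟨e, -⟩ := exists_equiv_prod Ω ε
  have hcl : IsClosed ((Ω.H01 : Submodule ℝ Ω.L2Pair) : Set Ω.L2Pair) :=
    Submodule.isClosed_topologicalClosure _
  have : CompleteSpace Ω.H01 := hcl.completeSpace_coe
  exact (completeSpace_congr (e := e.toEquiv) e.isUniformEmbedding).2 inferInstance

/-- The energy functional
`E(u) = ½ ∫_Ω ∑ᵢ (εᵢ |∇uᵢ|² + aᵢ |uᵢ|²) - ¼ ∫_Ω ∑ᵢⱼ gᵢⱼ |uᵢ|² |uⱼ|²`. -/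
def energy (a : Fin m → EuclideanSpace ℝ (Fin N) → ℝ) (g : Matrix (Fin m) (Fin m) ℝ)
    (u : SystemSpace Ω ε) : ℝ :=
  1 / 2 * ∫ x, ∑ i, ((ε i : ℝ) * ‖u.grad i x‖ ^ 2 + a i x * |u.comp i x| ^ 2) ∂Ω.measure
    - 1 / 4 * ∫ x, ∑ i, ∑ j, g i j * |u.comp i x| ^ 2 * |u.comp j x| ^ 2 ∂Ω.measure

variable [NeZero N]

/-- The Nehari functional `G(u) = ⟨E'(u), u⟩` of a functional `E : H → ℝ`. -/
def nehariFunctional (E : SystemSpace Ω ε → ℝ) (u : SystemSpace Ω ε) : ℝ :=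
  fderiv ℝ E u u

/-- The Nehari manifold `{u ∈ H \ {0} : ⟨E'(u), u⟩ = 0}` of `E`. -/
def nehariManifold (E : SystemSpace Ω ε → ℝ) : Set (SystemSpace Ω ε) :=
  {u | u ≠ 0 ∧ fderiv ℝ E u u = 0}

/-- The tangent space `{ξ ∈ H : ⟨G'(u), ξ⟩ = 0}` of the Nehari manifold at `u`. -/
abbrev nehariTangent (E : SystemSpace Ω ε → ℝ) (u : SystemSpace Ω ε) :
    Submodule ℝ (SystemSpace Ω ε) :=
  (fderiv ℝ (nehariFunctional E) u).ker

/-- The Riemannian gradient of `E` on the Nehari manifold at `u`: the Riesz representer, in the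
tangent space with the inner product `(·, ·)_H`, of the restriction of `E'(u)` to it. -/
def riemannianGradient (E : SystemSpace Ω ε → ℝ) (u : SystemSpace Ω ε) : nehariTangent E u :=
  (InnerProductSpace.toDual ℝ (nehariTangent E u)).symm
    ((fderiv ℝ E u).comp (nehariTangent E u).subtypeL)

/-- The property that characterizes the Riemannian gradient. -/
theorem inner_riemannianGradient (E : SystemSpace Ω ε → ℝ) (u : SystemSpace Ω ε)
    (ξ : SystemSpace Ω ε) (hξ : ξ ∈ nehariTangent E u) :
    inner ℝ (riemannianGradient E u : SystemSpace Ω ε) ξ = fderiv ℝ E u ξ := by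
  have h := InnerProductSpace.toDual_symm_apply (𝕜 := ℝ)
    (x := (⟨ξ, hξ⟩ : nehariTangent E u))
    (y := (fderiv ℝ E u).comp (nehariTangent E u).subtypeL)
  exact h

end SystemSpace

end

/-! Let J be the embedding of H into X = L⁴(Ω; ℝᵐ). Then E(u) = ½(‖u‖² + b(Ju, Ju)) - ¼ D(Ju)(Ju),
with b the potential form and D the quartic one, so E'(u) is the Riesz isometry plus a term that
sees u only through Ju. The variational argument, `palaisSmale_quarticEnergy`, uses only this shape.

On the Nehari manifold E = ¼ D(Ju)(Ju). Bounded energy thus bounds D(Ju)(Ju), coercivity c‖x‖⁴ ≤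
D(x)(x) bounds Ju, the constraint then bounds ‖u‖, and compactness of J gives a subsequence with Ju
→ x. If x = 0, the constraint forces ‖u‖ → 0. Otherwise G'(u)u = -2 D(Ju)(Ju) stays away from zero.
Since E'(u)u = 0, the multiplier in E'(u) = r - s G'(u), where r is the Riemannian gradient, is s =
(r, u)/G'(u)u, and it tends to zero with r. Hence E'(u) → 0, and u converges because the other term
of E'(u) does.

The concrete inputs are coercivity (`exists_le_quarticForm_self`), the derivative of the quartic
term (`hasFDerivAt_quarticForm_self`) and compactness (`SystemSpace.exists_embedding_four`). The
last interpolates at L⁴ between the Sobolev bound in L⁶ (`exists_sobolev_six`) and Rellich's theorem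
in L² (`totallyBounded_setOf_lintegral_fderiv_le`). Test functions extend by zero to ℝᴺ, so the
boundary of Ω plays no role. -/

noncomputable section

open BoundedDomain

/-! ### Palais-Smale sequences of an abstract quartic functional -/

section AbstractPalaisSmale

variable {H X : Type*} [NormedAddCommGroup H] [InnerProductSpace ℝ H]
  [NormedAddCommGroup X] [NormedSpace ℝ X]

/-- The functional `u ↦ ½ (‖u‖² + b(Ju, Ju)) - ¼ D(Ju)(Ju)`. -/
def quarticEnergy (J : H →L[ℝ] X) (b : X →L[ℝ] X →L[ℝ] ℝ) (D : X → X →L[ℝ] ℝ) (u : H) : ℝ :=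
  1 / 2 * (inner ℝ u u + b (J u) (J u)) - 1 / 4 * D (J u) (J u)

variable {J : H →L[ℝ] X} {b : X →L[ℝ] X →L[ℝ] ℝ} {D : X → X →L[ℝ] ℝ}

theorem hasFDerivAt_bilin_diag (hb : ∀ x y, b x y = b y x) (u : H) :
    HasFDerivAt (fun u => b (J u) (J u)) ((2 : ℝ) • (b (J u)).comp J) u := by
  have h := b.isBoundedBilinearMap.hasFDerivAt (J u, J u)
  have h2 := h.comp u (J.hasFDerivAt.prodMk J.hasFDerivAt)
  refine h2.congr_fderiv ?_
  ext ξ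
  simp [IsBoundedBilinearMap.deriv, hb (J ξ), two_mul]

theorem hasFDerivAt_inner_diag (u : H) :
    HasFDerivAt (fun u : H => inner ℝ u u) ((2 : ℝ) • innerSL ℝ u) u := by
  have h := (hasFDerivAt_id (𝕜 := ℝ) u).inner ℝ (hasFDerivAt_id (𝕜 := ℝ) u)
  refine h.congr_fderiv ?_
  ext ξ
  simp [fderivInnerCLM_apply, real_inner_comm ξ, two_mul]

/-- `hD` stands in for the symmetry and quartic homogeneity of D; no multilinear structure on D is
required. -/
theorem hasFDerivAt_quarticEnergy (hb : ∀ x y, b x y = b y x)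
    (hD : ∀ x, HasFDerivAt (fun x => D x x) ((4 : ℝ) • D x) x) (u : H) :
    HasFDerivAt (quarticEnergy J b D) (innerSL ℝ u + (b (J u) - D (J u)).comp J) u := by
  have h1 := ((hasFDerivAt_inner_diag u).add (hasFDerivAt_bilin_diag (J := J) hb u)).const_mul
    (1 / 2 : ℝ)
  have h2 := ((hD (J u)).comp u J.hasFDerivAt).const_mul (1 / 4 : ℝ)
  refine (h1.sub h2).congr_fderiv ?_
  ext ξ
  simp
  ring

/-- The Nehari functional has the closed form ‖u‖² + b(Ju, Ju) - D(Ju)(Ju), so it can be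
differentiated without a second derivative of the energy. -/
theorem hasFDerivAt_fderiv_quarticEnergy_self (hb : ∀ x y, b x y = b y x)
    (hD : ∀ x, HasFDerivAt (fun x => D x x) ((4 : ℝ) • D x) x) (u : H) :
    HasFDerivAt (fun u => fderiv ℝ (quarticEnergy J b D) u u)
      ((2 : ℝ) • innerSL ℝ u + ((2 : ℝ) • b (J u) - (4 : ℝ) • D (J u)).comp J) u := by
  have h1 := (hasFDerivAt_inner_diag u).add (hasFDerivAt_bilin_diag (J := J) hb u)
  have h2 := (hD (J u)).comp u J.hasFDerivAt
  have heq : (fun u => fderiv ℝ (quarticEnergy J b D) u u)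
      = fun u => inner ℝ u u + b (J u) (J u) - D (J u) (J u) := by
    funext u
    rw [(hasFDerivAt_quarticEnergy hb hD u).fderiv]
    simp
    ring
  rw [heq]
  refine (h1.sub h2).congr_fderiv ?_
  ext ξ
  simp
  ring

/-- If `e` and `r` agree on `ker γ`, and `e u = 0 ≠ γ u`, then `e - r` is the multiple of `γ`
determined by `r u`. -/
theorem eq_sub_smul_of_eqOn_ker {e γ r : H →L[ℝ] ℝ} {u : H} (hγ : γ u ≠ 0) (heu : e u = 0)
    (h : ∀ ξ, γ ξ = 0 → r ξ = e ξ) : e = r - (r u / γ u) • γ := by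
  ext ξ
  -- The test vector is the projection of ξ onto ker γ along u.
  have := h (ξ - (γ ξ / γ u) • u) (by simp [hγ])
  simp only [map_sub, map_smul, smul_eq_mul, heu] at this
  simp only [sub_apply, smul_apply, smul_eq_mul]
  rw [mul_zero, sub_zero] at this
  rw [← this]
  ring

/-- Palais-Smale condition on the Nehari manifold for a quartic functional whose lower order part
factors through a compact operator. -/
theorem palaisSmale_quarticEnergy [CompleteSpace H] (hb : ∀ x y, b x y = b y x)
    (hDc : Continuous D) (hD : ∀ x, HasFDerivAt (fun x => D x x) ((4 : ℝ) • D x) x)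
    {c : ℝ} (hc : 0 < c) (hcoer : ∀ x, c * ‖x‖ ^ 4 ≤ D x x)
    (hJ : ∀ (R : ℝ) (u : ℕ → H), (∀ n, ‖u n‖ ≤ R) →
      ∃ (x : X) (φ : ℕ → ℕ), StrictMono φ ∧ Tendsto (fun n => J (u (φ n))) atTop (𝓝 x))
    {E : H → ℝ} (hE : E = quarticEnergy J b D) {u r : ℕ → H}
    (hu : ∀ n, fderiv ℝ E (u n) (u n) = 0) (hbdd : ∃ C, ∀ n, |E (u n)| ≤ C)
    (hr : ∀ n ξ, fderiv ℝ (fun u => fderiv ℝ E u u) (u n) ξ = 0 →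
      inner ℝ (r n) ξ = fderiv ℝ E (u n) ξ)
    (hr0 : Tendsto (fun n => ‖r n‖) atTop (𝓝 0)) :
    ∃ (v : H) (φ : ℕ → ℕ), StrictMono φ ∧ Tendsto (u ∘ φ) atTop (𝓝 v) := by
  subst hE
  have hE' := fun u => (hasFDerivAt_quarticEnergy (J := J) hb hD u).fderiv
  have hG' := fun u => (hasFDerivAt_fderiv_quarticEnergy_self (J := J) hb hD u).fderiv
  obtain ⟨C, hC⟩ := hbdd
  have hN : ∀ n, ‖u n‖ ^ 2 = D (J (u n)) (J (u n)) - b (J (u n)) (J (u n)) := by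
    intro n
    have := hu n
    rw [hE'] at this
    simp only [add_apply, innerSL_apply_apply, real_inner_self_eq_norm_sq,
      ContinuousLinearMap.comp_apply, sub_apply] at this
    linarith
  -- Substituting the constraint into the energy leaves ¼ D(Ju)(Ju).
  have hQ : ∀ n, D (J (u n)) (J (u n)) ≤ 4 * C := by
    intro n
    have h1 := (le_abs_self _).trans (hC n)
    rw [quarticEnergy, real_inner_self_eq_norm_sq, hN n] at h1
    linarith
  -- The summand 1 avoids a fourth root: t⁴ ≤ A implies t ≤ A + 1. The bound on ‖u n‖ below is
  -- obtained likewise from its square.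
  have hJb : ∀ n, ‖J (u n)‖ ≤ 4 * C / c + 1 := by
    intro n
    have h1 : ‖J (u n)‖ ^ 4 ≤ 4 * C / c := by
      rw [le_div_iff₀ hc, mul_comm]
      exact (hcoer _).trans (hQ n)
    by_contra! h2
    have h0 : 0 ≤ 4 * C / c := le_trans (by positivity) h1
    have h3 : 1 ≤ ‖J (u n)‖ := by linarith
    have h4 : ‖J (u n)‖ ≤ ‖J (u n)‖ ^ 4 := le_self_pow₀ h3 (by norm_num)
    linarith
  set M := 4 * C / c + 1
  have hM0 : 0 ≤ M := (norm_nonneg _).trans (hJb 0)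
  have hub : ∀ n, ‖u n‖ ≤ 4 * C + ‖b‖ * M * M + 1 := by
    intro n
    have h1 : ‖u n‖ ^ 2 ≤ 4 * C + ‖b‖ * M * M := by
      rw [hN n]
      have h2 : ‖b (J (u n)) (J (u n))‖ ≤ ‖b‖ * M * M :=
        (b.le_opNorm₂ _ _).trans (by gcongr <;> exact hJb n)
      have h3 := neg_le_of_abs_le h2
      linarith [hQ n]
    nlinarith [sq_nonneg (‖u n‖ - 1), norm_nonneg (u n)]
  set R := 4 * C + ‖b‖ * M * M + 1
  obtain ⟨x, φ, hφ, hx⟩ := hJ R u hub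
  have hJc : Continuous fun L : X →L[ℝ] ℝ => L.comp J :=
    ((ContinuousLinearMap.compL ℝ H X ℝ).flip J).continuous
  have hDx : Tendsto (fun n => D (J (u (φ n)))) atTop (𝓝 (D x)) := (hDc.tendsto x).comp hx
  have hbx : Tendsto (fun n => b (J (u (φ n)))) atTop (𝓝 (b x)) := (b.continuous.tendsto x).comp hx
  have hDxx : Tendsto (fun n => D (J (u (φ n))) (J (u (φ n)))) atTop (𝓝 (D x x)) :=
    (isBoundedBilinearMap_apply.continuous.tendsto (D x, x)).comp (hDx.prodMk_nhds hx)
  have hbxx : Tendsto (fun n => b (J (u (φ n))) (J (u (φ n)))) atTop (𝓝 (b x x)) :=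
    (isBoundedBilinearMap_apply.continuous.tendsto (b x, x)).comp (hbx.prodMk_nhds hx)
  -- For x = 0 the multiplier is not controlled, but the constraint writes ‖u‖² through Ju alone and
  -- gives u → 0 directly.
  by_cases hx0 : x = 0
  · refine ⟨0, φ, hφ, ?_⟩
    have h1 : Tendsto (fun n => ‖u (φ n)‖ ^ 2) atTop (𝓝 0) := by
      simp only [hN]
      simpa [hx0] using hDxx.sub hbxx
    have h2 := h1.sqrt
    simp only [Real.sqrt_zero, Real.sqrt_sq (norm_nonneg _)] at h2
    exact tendsto_zero_iff_norm_tendsto_zero.2 h2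
  have hQx : 0 < D x x := lt_of_lt_of_le (by positivity) (hcoer x)
  -- γ n is G'(u n), the functional whose kernel is the tangent space.
  set γ : ℕ → (H →L[ℝ] ℝ) := fun n =>
    (2 : ℝ) • innerSL ℝ (u n) + ((2 : ℝ) • b (J (u n)) - (4 : ℝ) • D (J (u n))).comp J with hγ
  have hγu : ∀ n, γ n (u n) = -2 * D (J (u n)) (J (u n)) := by
    intro n
    have := hN n
    simp only [hγ, add_apply, innerSL_apply_apply, smul_apply,
      real_inner_self_eq_norm_sq, ContinuousLinearMap.comp_apply, sub_apply,
      smul_eq_mul]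
    linarith
  -- The Lagrange multiplier identity solved for u, as an equation in the dual space; it holds once
  -- D(Ju)(Ju) > 0, so that γ does not vanish at u.
  have hrep : ∀ᶠ n in atTop, innerSL ℝ (u (φ n)) = innerSL ℝ (r (φ n))
      - (inner ℝ (r (φ n)) (u (φ n)) / (-2 * D (J (u (φ n))) (J (u (φ n))))) • γ (φ n)
      - (b (J (u (φ n))) - D (J (u (φ n)))).comp J := by
    filter_upwards [hDxx.eventually_const_lt hQx] with n hn
    have h := eq_sub_smul_of_eqOn_ker (e := fderiv ℝ (quarticEnergy J b D) (u (φ n)))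
      (γ := γ (φ n)) (r := innerSL ℝ (r (φ n))) (u := u (φ n)) (by rw [hγu]; nlinarith)
      (hu _) (fun ξ hξ => hr (φ n) ξ (by rw [hG']; exact hξ))
    rw [hE', hγu] at h
    exact eq_sub_of_add_eq h
  have hri : Tendsto (fun n => inner ℝ (r (φ n)) (u (φ n))) atTop (𝓝 0) := by
    refine squeeze_zero_norm (a := fun n => ‖r (φ n)‖ * R) (fun n => ?_) ?_
    · exact (norm_inner_le_norm _ _).trans (by gcongr; exact hub _)
    · simpa using (hr0.comp hφ.tendsto_atTop).mul_const R
  have hs : Tendsto (fun n => inner ℝ (r (φ n)) (u (φ n)) / (-2 * D (J (u (φ n))) (J (u (φ n)))))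
      atTop (𝓝 0) := by
    have := hri.div (hDxx.const_mul (-2)) (by nlinarith)
    rwa [zero_div] at this
  have hγb : IsBoundedUnder (· ≤ ·) atTop (fun n => ‖γ (φ n)‖) := by
    have h1 : Tendsto (fun n => ((2 : ℝ) • b (J (u (φ n))) - (4 : ℝ) • D (J (u (φ n)))).comp J)
        atTop (𝓝 (((2 : ℝ) • b x - (4 : ℝ) • D x).comp J)) :=
      (hJc.tendsto _).comp ((hbx.const_smul (2 : ℝ)).sub (hDx.const_smul (4 : ℝ)))
    obtain ⟨B, hB⟩ := h1.norm.isBoundedUnder_le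
    refine ⟨2 * R + B, ?_⟩
    rw [eventually_map] at hB ⊢
    filter_upwards [hB] with n hn
    refine (norm_add_le _ _).trans (add_le_add ?_ hn)
    rw [norm_smul, innerSL_apply_norm]
    norm_num
    exact hub _
  have hsγ : Tendsto (fun n => (inner ℝ (r (φ n)) (u (φ n)) /
      (-2 * D (J (u (φ n))) (J (u (φ n))))) • γ (φ n)) atTop (𝓝 0) :=
    hs.zero_smul_isBoundedUnder_le hγb
  have hr1 : Tendsto (fun n => innerSL ℝ (r (φ n))) atTop (𝓝 0) := by
    refine tendsto_zero_iff_norm_tendsto_zero.2 ?_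
    simpa only [innerSL_apply_norm, Function.comp_def] using hr0.comp hφ.tendsto_atTop
  have hlim : Tendsto (fun n => innerSL ℝ (u (φ n))) atTop (𝓝 (0 - 0 - (b x - D x).comp J)) :=
    ((hr1.sub hsγ).sub ((hJc.tendsto _).comp (hbx.sub hDx))).congr' (hrep.mono fun n h => h.symm)
  refine ⟨(InnerProductSpace.toDual ℝ H).symm (0 - 0 - (b x - D x).comp J), φ, hφ, ?_⟩
  refine (((InnerProductSpace.toDual ℝ H).symm.continuous.tendsto _).comp hlim).congr fun n => ?_
  exact (InnerProductSpace.toDual ℝ H).symm_apply_apply (u (φ n))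

end AbstractPalaisSmale

/-! ### The Sobolev inequality in L⁶ for test functions -/

section Sobolev

open scoped NNReal

theorem eLpNorm_le_eLpNorm_mul_rpow_of_support_subset {α F : Type*} [MeasurableSpace α]
    [NormedAddCommGroup F] {μ : Measure α} {s : Set α} {f : α → F}
    (hf : AEStronglyMeasurable f μ) (hs : f.support ⊆ s) {p q : ℝ≥0∞} (hpq : p ≤ q) :
    eLpNorm f p μ ≤ eLpNorm f q μ * μ s ^ (1 / p.toReal - 1 / q.toReal) := by
  have h := eLpNorm_le_eLpNorm_mul_rpow_measure_univ (μ := μ.restrict s) hpq hf.restrict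
  rwa [eLpNorm_restrict_eq_of_support_subset hs, eLpNorm_restrict_eq_of_support_subset hs,
    Measure.restrict_apply_univ] at h

/-- Hölder's inequality on a set of finite measure. In dimensions one and two the route to L⁶ starts
from an Lᵖ norm of the gradient with p < 2, and this returns to L². -/
theorem exists_eLpNorm_fderiv_le_two {E : Type*} [NormedAddCommGroup E] [NormedSpace ℝ E]
    [FiniteDimensional ℝ E] [MeasurableSpace E] [BorelSpace E] {μ : Measure E}
    [IsFiniteMeasureOnCompacts μ] {s : Set E}
    (hs : Bornology.IsBounded s) {p : ℝ≥0∞} (hp0 : p ≠ 0) (hp : p ≤ 2) :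
    ∃ C : ℝ≥0, ∀ φ : E → ℝ, ContDiff ℝ 1 φ → tsupport φ ⊆ s →
      eLpNorm (fderiv ℝ φ) p μ ≤ C * eLpNorm (fderiv ℝ φ) 2 μ := by
  have : ProperSpace E := FiniteDimensional.proper ℝ E
  have hμ : μ s < ∞ := hs.measure_lt_top
  have hpt : p ≠ ∞ := ne_top_of_le_ne_top (by simp) hp
  refine ⟨(μ s ^ (1 / p.toReal - 1 / (2 : ℝ≥0∞).toReal)).toNNReal, fun φ hφ hsub => ?_⟩
  have hsupp : (fderiv ℝ φ).support ⊆ s :=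
    (subset_tsupport _).trans ((tsupport_fderiv_subset ℝ).trans hsub)
  rw [ENNReal.coe_toNNReal, mul_comm]
  · exact eLpNorm_le_eLpNorm_mul_rpow_of_support_subset
      (hφ.continuous_fderiv one_ne_zero).aestronglyMeasurable hsupp hp
  · refine ENNReal.rpow_ne_top_of_nonneg ?_ hμ.ne
    rw [sub_nonneg]
    exact one_div_le_one_div_of_le (ENNReal.toReal_pos hp0 hpt)
      (ENNReal.toReal_mono (by simp) hp)

/-- The fundamental theorem of calculus on a half-line, transported by a measure-preserving isometry
between ℝ and its one-dimensional Euclidean model. -/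
theorem enorm_le_eLpNorm_fderiv_one {φ : EuclideanSpace ℝ (Fin 1) → ℝ} (hφ : ContDiff ℝ 1 φ)
    (hc : HasCompactSupport φ) (x : EuclideanSpace ℝ (Fin 1)) :
    ‖φ x‖ₑ ≤ eLpNorm (fderiv ℝ φ) 1 volume := by
  let e := (OrthonormalBasis.singleton (Fin 1) ℝ).repr
  have hψ : ContDiff ℝ 1 (φ ∘ e) := hφ.comp e.contDiff
  have hψc : HasCompactSupport (φ ∘ e) := hc.comp_homeomorph e.toHomeomorph
  have h := HasCompactSupport.enorm_le_lintegral_Ici_deriv hψ hψc (e.symm x)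
  rw [Function.comp_apply, e.apply_symm_apply] at h
  refine h.trans ((setLIntegral_le_lintegral _ _).trans ?_)
  have hmp : MeasurePreserving e volume volume :=
    (OrthonormalBasis.singleton (Fin 1) ℝ).measurePreserving_repr
  rw [eLpNorm_one_eq_lintegral_enorm,
    ← hmp.lintegral_comp (hφ.continuous_fderiv one_ne_zero).enorm.measurable]
  refine lintegral_mono fun y => ?_
  have hd : deriv (φ ∘ e) y = fderiv ℝ φ (e y) (e 1) := by
    have h1 : HasDerivAt e (e 1) y := by
      have := (e.toContinuousLinearEquiv.hasFDerivAt (x := y)).hasDerivAt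
      simpa using this
    exact (((hφ.differentiable one_ne_zero) (e y)).hasFDerivAt.comp_hasDerivAt y h1).deriv
  rw [hd]
  have h2 := (fderiv ℝ φ (e y)).le_opENorm (e 1)
  have h3 : ‖e 1‖ₑ = 1 := by
    have h4 : ‖e 1‖ = 1 := (e.norm_map 1).trans norm_one
    rw [← ofReal_norm, h4, ENNReal.ofReal_one]
  rwa [h3, mul_one] at h2

/-- Sobolev inequality `‖φ‖_{L⁶} ≤ C ‖∇φ‖_{L²}` in dimension at most three. -/
theorem exists_sobolev_six {N : ℕ} [NeZero N] (hN : N ≤ 3) {s : Set (EuclideanSpace ℝ (Fin N))}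
    (hs : Bornology.IsBounded s) :
    ∃ C : ℝ≥0, ∀ φ : EuclideanSpace ℝ (Fin N) → ℝ, ContDiff ℝ 1 φ → HasCompactSupport φ →
      tsupport φ ⊆ s → eLpNorm φ 6 volume ≤ C * eLpNorm (fderiv ℝ φ) 2 volume := by
  have hN0 : N ≠ 0 := NeZero.ne N
  obtain rfl | rfl | rfl : N = 1 ∨ N = 2 ∨ N = 3 := by omega
  · obtain ⟨C, hC⟩ := exists_eLpNorm_fderiv_le_two (μ := volume) hs (p := 1) one_ne_zero one_le_two
    have hμ : volume s < ∞ := hs.measure_lt_top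
    refine ⟨C * (volume s ^ (1 / (6 : ℝ))).toNNReal, fun φ hφ hc hsub => ?_⟩
    have hinf : eLpNorm φ ∞ volume ≤ eLpNorm (fderiv ℝ φ) 1 volume := by
      rw [eLpNorm_exponent_top]
      exact eLpNormEssSup_le_of_ae_enorm_bound
        (.of_forall fun x => enorm_le_eLpNorm_fderiv_one hφ hc x)
    have h := eLpNorm_le_eLpNorm_mul_rpow_of_support_subset (μ := volume) (p := 6)
      hφ.continuous.aestronglyMeasurable ((subset_tsupport φ).trans hsub) le_top
    refine h.trans ?_
    have hexp : 1 / (6 : ℝ≥0∞).toReal - 1 / (∞ : ℝ≥0∞).toReal = 1 / (6 : ℝ) := by simp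
    rw [hexp, ENNReal.coe_mul,
      ENNReal.coe_toNNReal (ENNReal.rpow_ne_top_of_nonneg (by norm_num) hμ.ne), mul_right_comm]
    gcongr
    exact hinf.trans (hC φ hφ hsub)
  -- For N = 2 the exponent with Sobolev conjugate 6 is 3/2, as 1/6 = 2/3 - 1/2; for N = 3 it is 2
  -- itself.
  · have h32 : ((3 / 2 : ℝ≥0) : ℝ≥0∞) ≤ 2 := by
      rw [show (2 : ℝ≥0∞) = ((2 : ℝ≥0) : ℝ≥0∞) by simp, ENNReal.coe_le_coe,
        ← NNReal.coe_le_coe]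
      norm_num
    obtain ⟨C, hC⟩ := exists_eLpNorm_fderiv_le_two (μ := volume) hs (by simp) h32
    refine ⟨eLpNormLESNormFDerivOfEqInnerConst
      (volume : Measure (EuclideanSpace ℝ (Fin 2))) (3 / 2 : ℝ≥0) * C, fun φ hφ hc hsub => ?_⟩
    have h := eLpNorm_le_eLpNorm_fderiv_of_eq_inner (p := 3 / 2) (p' := 6) volume hφ hc
      (by rw [← NNReal.coe_le_coe]; norm_num) (by simp) (by simp; norm_num)
    rw [ENNReal.coe_mul, mul_assoc]
    refine (le_of_eq (by simp)).trans (h.trans ?_)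
    gcongr
    exact hC φ hφ hsub
  · refine ⟨eLpNormLESNormFDerivOfEqInnerConst
      (volume : Measure (EuclideanSpace ℝ (Fin 3))) 2, fun φ hφ hc hsub => ?_⟩
    have h := eLpNorm_le_eLpNorm_fderiv_of_eq_inner (p := 2) (p' := 6) volume hφ hc
      (by norm_num) (by simp) (by simp; norm_num)
    simpa using h

end Sobolev

/-! ### Approximation by ball averages in L² -/

section Rellich

open scoped NNReal

/-- Cauchy-Schwarz inequality against the constant function on a probability space. -/
theorem lintegral_sq_le_lintegral_sq {α : Type*} [MeasurableSpace α] {ν : Measure α}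
    [IsProbabilityMeasure ν] {f : α → ℝ≥0∞} (hf : AEMeasurable f ν) :
    (∫⁻ x, f x ∂ν) ^ 2 ≤ ∫⁻ x, f x ^ 2 ∂ν := by
  have h := ENNReal.lintegral_mul_le_Lp_mul_Lq ν Real.HolderConjugate.two_two hf
    (aemeasurable_const (b := 1))
  simp only [Pi.mul_apply, mul_one, ENNReal.one_rpow, lintegral_const, measure_univ] at h
  calc (∫⁻ x, f x ∂ν) ^ 2 ≤ ((∫⁻ x, f x ^ (2 : ℝ) ∂ν) ^ (1 / 2 : ℝ)) ^ 2 := by gcongr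
    _ = ∫⁻ x, f x ^ 2 ∂ν := by
      rw [← ENNReal.rpow_natCast, ← ENNReal.rpow_mul]
      norm_num

theorem isProbabilityMeasure_cond_ball {E : Type*} [NormedAddCommGroup E] [ProperSpace E]
    [MeasurableSpace E] {μ : Measure E} [μ.IsOpenPosMeasure] [IsFiniteMeasureOnCompacts μ]
    {δ : ℝ} (hδ : 0 < δ) (y : E) :
    IsProbabilityMeasure (ProbabilityTheory.cond μ (Metric.ball y δ)) :=
  ProbabilityTheory.cond_isProbabilityMeasure_of_finite (Metric.measure_ball_pos μ y hδ).ne'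
    measure_ball_lt_top.ne

theorem lintegral_cond_ball {E : Type*} [NormedAddCommGroup E] [MeasurableSpace E] [BorelSpace E]
    {μ : Measure E} [μ.IsAddHaarMeasure] (f : E → ℝ≥0∞) (δ : ℝ) (y : E) :
    ∫⁻ z, f z ∂ProbabilityTheory.cond μ (Metric.ball y δ) =
      (μ (Metric.ball 0 δ))⁻¹ * ∫⁻ z in Metric.ball y δ, f z ∂μ := by
  rw [ProbabilityTheory.cond, lintegral_smul_measure, Measure.addHaar_ball_center, smul_eq_mul]

variable {E : Type*} [NormedAddCommGroup E] [NormedSpace ℝ E]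

/-- Integrate the derivative along the segment from x to x + h and apply Cauchy-Schwarz in the
parameter. -/
theorem enorm_sub_sq_le_lintegral_fderiv {φ : E → ℝ} (hφ : ContDiff ℝ 1 φ) (x h : E) :
    ‖φ (x + h) - φ x‖ₑ ^ 2 ≤
      ‖h‖ₑ ^ 2 * ∫⁻ t in Ioc (0 : ℝ) 1, ‖fderiv ℝ φ (x + t • h)‖ₑ ^ 2 := by
  have hcont : Continuous fun t : ℝ => fderiv ℝ φ (x + t • h) :=
    (hφ.continuous_fderiv one_ne_zero).comp (by fun_prop)
  have hd : ∀ t : ℝ, HasDerivAt (fun t : ℝ => φ (x + t • h)) (fderiv ℝ φ (x + t • h) h) t := by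
    intro t
    have h1 : HasDerivAt (fun t : ℝ => x + t • h) h t := by
      simpa using ((hasDerivAt_id t).smul_const h).const_add x
    exact ((hφ.differentiable one_ne_zero) _).hasFDerivAt.comp_hasDerivAt t h1
  have hi := intervalIntegral.integral_eq_sub_of_hasDerivAt (a := 0) (b := 1)
    (fun t _ => hd t) ((hcont.clm_apply continuous_const).intervalIntegrable 0 1)
  simp only [one_smul, zero_smul, add_zero] at hi
  rw [← hi, intervalIntegral.integral_of_le zero_le_one]
  have : IsProbabilityMeasure (volume.restrict (Ioc (0 : ℝ) 1)) := ⟨by simp⟩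
  calc ‖∫ t in Ioc (0 : ℝ) 1, fderiv ℝ φ (x + t • h) h‖ₑ ^ 2
      ≤ (∫⁻ t in Ioc (0 : ℝ) 1, ‖fderiv ℝ φ (x + t • h) h‖ₑ) ^ 2 := by
        gcongr; exact enorm_integral_le_lintegral_enorm _
    _ ≤ ∫⁻ t in Ioc (0 : ℝ) 1, ‖fderiv ℝ φ (x + t • h) h‖ₑ ^ 2 :=
        lintegral_sq_le_lintegral_sq
          (hcont.clm_apply continuous_const).enorm.measurable.aemeasurable
    _ ≤ ∫⁻ t in Ioc (0 : ℝ) 1, ‖h‖ₑ ^ 2 * ‖fderiv ℝ φ (x + t • h)‖ₑ ^ 2 := by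
        refine lintegral_mono fun t => ?_
        rw [← mul_pow, mul_comm]
        gcongr
        exact ContinuousLinearMap.le_opENorm _ _
    _ = _ := lintegral_const_mul _ (hcont.enorm.measurable.pow_const 2)

variable [FiniteDimensional ℝ E]
  [MeasurableSpace E] [BorelSpace E] {μ : Measure E} [μ.IsAddHaarMeasure]

/-- Translates of a `C¹` function in `L²`. -/
theorem lintegral_enorm_translate_sub_sq_le {φ : E → ℝ} (hφ : ContDiff ℝ 1 φ) (h : E) :
    ∫⁻ x, ‖φ (x + h) - φ x‖ₑ ^ 2 ∂μ ≤ ‖h‖ₑ ^ 2 * ∫⁻ x, ‖fderiv ℝ φ x‖ₑ ^ 2 ∂μ := by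
  have hcf : Continuous fun p : E × ℝ => fderiv ℝ φ (p.1 + p.2 • h) :=
    (hφ.continuous_fderiv one_ne_zero).comp (by fun_prop)
  calc ∫⁻ x, ‖φ (x + h) - φ x‖ₑ ^ 2 ∂μ
      ≤ ∫⁻ x, (‖h‖ₑ ^ 2 * ∫⁻ t in Ioc (0 : ℝ) 1, ‖fderiv ℝ φ (x + t • h)‖ₑ ^ 2) ∂μ :=
        lintegral_mono fun x => enorm_sub_sq_le_lintegral_fderiv hφ x h
    _ = ‖h‖ₑ ^ 2 * ∫⁻ x, (∫⁻ t in Ioc (0 : ℝ) 1, ‖fderiv ℝ φ (x + t • h)‖ₑ ^ 2) ∂μ :=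
        lintegral_const_mul' _ _ (by simp)
    _ = ‖h‖ₑ ^ 2 * ∫⁻ t in Ioc (0 : ℝ) 1, ∫⁻ x, ‖fderiv ℝ φ (x + t • h)‖ₑ ^ 2 ∂μ := by
        rw [lintegral_lintegral_swap]
        exact (hcf.enorm.measurable.pow_const 2).aemeasurable
    _ = ‖h‖ₑ ^ 2 * ∫⁻ x, ‖fderiv ℝ φ x‖ₑ ^ 2 ∂μ := by
        simp_rw [fun t : ℝ => lintegral_add_right_eq_self (μ := μ)
          (fun x => ‖fderiv ℝ φ x‖ₑ ^ 2) (t • h)]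
        simp

variable (μ) in
/-- The average of `f` over the ball of radius `δ` about `y`. -/
def ballAverage (f : E → ℝ) (δ : ℝ) (y : E) : ℝ :=
  ∫ z, f z ∂ProbabilityTheory.cond μ (Metric.ball y δ)

/-- Cauchy-Schwarz on the ball. The bound is uniform in y, so for fixed δ the averages of an
L²-bounded family are bounded numbers. -/
theorem enorm_ballAverage_sq_le {f : E → ℝ} (hf : Continuous f) {δ : ℝ} (hδ : 0 < δ) (y : E) :
    ‖ballAverage μ f δ y‖ₑ ^ 2 ≤ (μ (Metric.ball 0 δ))⁻¹ * ∫⁻ x, ‖f x‖ₑ ^ 2 ∂μ := by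
  have : ProperSpace E := FiniteDimensional.proper ℝ E
  have := isProbabilityMeasure_cond_ball (μ := μ) hδ y
  calc ‖ballAverage μ f δ y‖ₑ ^ 2
      ≤ (∫⁻ z, ‖f z‖ₑ ∂ProbabilityTheory.cond μ (Metric.ball y δ)) ^ 2 := by
        gcongr; exact enorm_integral_le_lintegral_enorm _
    _ ≤ ∫⁻ z, ‖f z‖ₑ ^ 2 ∂ProbabilityTheory.cond μ (Metric.ball y δ) :=
        lintegral_sq_le_lintegral_sq hf.enorm.measurable.aemeasurable
    _ ≤ _ := by
        rw [lintegral_cond_ball]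
        gcongr
        exact Measure.restrict_le_self

/-- The ball of radius δ about y lies in the ball of radius 2δ about x, so the bound involves only
translates of f at x. As y has disappeared from it, y may later be any function of x. -/
theorem enorm_sub_ballAverage_sq_le {f : E → ℝ} (hf : Continuous f) (hc : HasCompactSupport f)
    {δ : ℝ} {x y : E} (hxy : dist y x < δ) :
    ‖f x - ballAverage μ f δ y‖ₑ ^ 2 ≤ (μ (Metric.ball 0 δ))⁻¹ *
      ∫⁻ h in Metric.ball 0 (2 * δ), ‖f (x + h) - f x‖ₑ ^ 2 ∂μ := by
  have hδ : 0 < δ := dist_nonneg.trans_lt hxy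
  have : ProperSpace E := FiniteDimensional.proper ℝ E
  have := isProbabilityMeasure_cond_ball (μ := μ) hδ y
  set ν := ProbabilityTheory.cond μ (Metric.ball y δ) with hν
  have hint : Integrable f ν :=
    ((hf.integrable_of_hasCompactSupport hc).restrict).smul_measure
      (ENNReal.inv_ne_top.2 (Metric.measure_ball_pos μ y hδ).ne')
  have heq : f x - ballAverage μ f δ y = ∫ z, (f x - f z) ∂ν := by
    rw [integral_sub (integrable_const _) hint, integral_const]
    simp [ballAverage, hν]
  calc ‖f x - ballAverage μ f δ y‖ₑ ^ 2
      ≤ (∫⁻ z, ‖f x - f z‖ₑ ∂ν) ^ 2 := by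
        rw [heq]; gcongr; exact enorm_integral_le_lintegral_enorm _
    _ ≤ ∫⁻ z, ‖f x - f z‖ₑ ^ 2 ∂ν :=
        lintegral_sq_le_lintegral_sq (by fun_prop)
    _ = (μ (Metric.ball 0 δ))⁻¹ * ∫⁻ z in Metric.ball y δ, ‖f x - f z‖ₑ ^ 2 ∂μ :=
        lintegral_cond_ball _ _ _
    _ ≤ (μ (Metric.ball 0 δ))⁻¹ * ∫⁻ z in Metric.ball x (2 * δ), ‖f x - f z‖ₑ ^ 2 ∂μ := by
        gcongr
        exact Metric.ball_subset_ball' (by linarith)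
    _ = _ := by
        congr 1
        have hmp := measurePreserving_add_left μ x
        have hpre : (x + ·) ⁻¹' Metric.ball x (2 * δ) = Metric.ball 0 (2 * δ) := by
          simp [preimage_add_ball]
        rw [← hpre, hmp.setLIntegral_comp_preimage Metric.isOpen_ball.measurableSet
          (f := fun z => ‖f z - f x‖ₑ ^ 2) (by fun_prop)]
        simp_rw [enorm_sub_rev]

/-- A compactly supported `C¹` function is approximated in `L²` by its averages over balls of
radius `δ` about points at distance less than `δ`. -/
theorem setLIntegral_enorm_sub_ballAverage_sq_le {φ : E → ℝ} (hφ : ContDiff ℝ 1 φ)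
    (hc : HasCompactSupport φ) {δ : ℝ} (hδ : 0 < δ) {s : Set E} (hs : MeasurableSet s) {p : E → E}
    (hp : ∀ x ∈ s, dist (p x) x < δ) :
    ∫⁻ x in s, ‖φ x - ballAverage μ φ δ (p x)‖ₑ ^ 2 ∂μ ≤
      ENNReal.ofReal (2 ^ Module.finrank ℝ E) * ENNReal.ofReal (2 * δ) ^ 2 *
        ∫⁻ x, ‖fderiv ℝ φ x‖ₑ ^ 2 ∂μ := by
  have hμ0 : μ (Metric.ball 0 δ) ≠ 0 := (Metric.measure_ball_pos μ 0 hδ).ne'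
  have hμt : μ (Metric.ball 0 δ) ≠ ∞ := measure_ball_lt_top.ne
  have hcont : Continuous φ := hφ.continuous
  calc ∫⁻ x in s, ‖φ x - ballAverage μ φ δ (p x)‖ₑ ^ 2 ∂μ
      ≤ ∫⁻ x in s, (μ (Metric.ball 0 δ))⁻¹ *
          ∫⁻ h in Metric.ball 0 (2 * δ), ‖φ (x + h) - φ x‖ₑ ^ 2 ∂μ ∂μ :=
        setLIntegral_mono' hs fun x hx => enorm_sub_ballAverage_sq_le hcont hc (hp x hx)
    _ ≤ ∫⁻ x, (μ (Metric.ball 0 δ))⁻¹ *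
          ∫⁻ h in Metric.ball 0 (2 * δ), ‖φ (x + h) - φ x‖ₑ ^ 2 ∂μ ∂μ :=
        setLIntegral_le_lintegral _ _
    _ = (μ (Metric.ball 0 δ))⁻¹ *
          ∫⁻ h in Metric.ball 0 (2 * δ), ∫⁻ x, ‖φ (x + h) - φ x‖ₑ ^ 2 ∂μ ∂μ := by
        rw [lintegral_const_mul' _ _ (ENNReal.inv_ne_top.2 hμ0), lintegral_lintegral_swap]
        exact Measurable.aemeasurable (by fun_prop)
    _ ≤ (μ (Metric.ball 0 δ))⁻¹ * ∫⁻ _ in Metric.ball 0 (2 * δ),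
          (ENNReal.ofReal (2 * δ) ^ 2 * ∫⁻ x, ‖fderiv ℝ φ x‖ₑ ^ 2 ∂μ) ∂μ := by
        refine mul_le_mul' le_rfl (setLIntegral_mono' measurableSet_ball fun h hh => ?_)
        refine (lintegral_enorm_translate_sub_sq_le hφ h).trans ?_
        gcongr
        rw [← ofReal_norm]
        exact ENNReal.ofReal_le_ofReal (mem_ball_zero_iff.1 hh).le
    _ = _ := by
        -- The factor 2 ^ dim is the ratio of the volumes of the balls of radii 2δ and δ.
        rw [setLIntegral_const, Measure.addHaar_ball_mul_of_pos μ 0 two_pos δ]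
        calc _ = ((μ (Metric.ball 0 δ))⁻¹ * μ (Metric.ball 0 δ)) *
              (ENNReal.ofReal (2 ^ Module.finrank ℝ E) * ENNReal.ofReal (2 * δ) ^ 2 *
                ∫⁻ x, ‖fderiv ℝ φ x‖ₑ ^ 2 ∂μ) := by ring
          _ = _ := by rw [ENNReal.inv_mul_cancel hμ0 hμt, one_mul]

end Rellich

/-! ### Rellich's theorem on bounded sets -/

section TotallyBounded

open scoped NNReal

theorem totallyBounded_of_forall_exists_dist_le {α : Type*} [PseudoMetricSpace α] {s : Set α}
    (h : ∀ ε > 0, ∃ K, TotallyBounded K ∧ ∀ x ∈ s, ∃ y ∈ K, dist x y ≤ ε) :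
    TotallyBounded s := by
  refine Metric.totallyBounded_iff.2 fun ε hε => ?_
  obtain ⟨K, hK, hsK⟩ := h (ε / 3) (by positivity)
  obtain ⟨t, ht, hKt⟩ := Metric.totallyBounded_iff.1 hK (ε / 3) (by positivity)
  refine ⟨t, ht, fun x hx => ?_⟩
  obtain ⟨y, hy, hxy⟩ := hsK x hx
  obtain ⟨z, hz, hyz⟩ := mem_iUnion₂.1 (hKt hy)
  refine mem_iUnion₂.2 ⟨z, hz, ?_⟩
  rw [Metric.mem_ball] at hyz ⊢
  linarith [dist_triangle x y z]

theorem enorm_sq_eq_lintegral {α F : Type*} [MeasurableSpace α] [NormedAddCommGroup F]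
    {ν : Measure α} (f : Lp F 2 ν) : ‖f‖ₑ ^ 2 = ∫⁻ x, ‖f x‖ₑ ^ 2 ∂ν := by
  have h := eLpNorm_nnreal_pow_eq_lintegral (f := f) (μ := ν) (p := 2) two_ne_zero
  rw [Lp.enorm_def]
  simpa using h

/-- Uniformly bounded functions of a measurable map with finitely many values lie in a compact
subset of `L²`. -/
theorem exists_isCompact_comp_mem {α : Type*} [MeasurableSpace α] {ν : Measure α}
    [IsFiniteMeasure ν] {n : ℕ} {k : α → Fin n} (hk : Measurable k) (B : ℝ) :
    ∃ K : Set (Lp ℝ 2 ν), IsCompact K ∧ ∀ c : Fin n → ℝ, (∀ j, |c j| ≤ B) →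
      ∃ f ∈ K, f =ᵐ[ν] fun x => c (k x) := by
  let Φ : (Fin n → ℝ) → Lp ℝ 2 ν := fun c => ∑ j, c j •
    indicatorConstLp 2 (hk (measurableSet_singleton j)) (measure_ne_top ν _) (1 : ℝ)
  have hΦ : Continuous Φ := by fun_prop
  refine ⟨Φ '' (Set.pi univ fun _ => Icc (-B) B), (isCompact_univ_pi fun _ => isCompact_Icc).image hΦ,
    fun c hc => ⟨Φ c, mem_image_of_mem _ fun j _ => abs_le.1 (hc j), ?_⟩⟩
  have h1 := Lp.coeFn_finsetSum Finset.univ fun j => c j •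
    indicatorConstLp (μ := ν) 2 (hk (measurableSet_singleton j)) (measure_ne_top ν _) (1 : ℝ)
  have h2 : ∀ᵐ x ∂ν, ∀ j, (c j • indicatorConstLp (μ := ν) 2 (hk (measurableSet_singleton j))
      (measure_ne_top ν _) (1 : ℝ) : Lp ℝ 2 ν) x = c j * (k ⁻¹' {j}).indicator (fun _ => 1) x := by
    refine ae_all_iff.2 fun j => ?_
    filter_upwards [Lp.coeFn_smul (c j) (indicatorConstLp (μ := ν) 2
      (hk (measurableSet_singleton j)) (measure_ne_top ν _) (1 : ℝ)),
      indicatorConstLp_coeFn (μ := ν) (p := 2) (hs := hk (measurableSet_singleton j))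
        (hμs := measure_ne_top ν _) (c := (1 : ℝ))] with x hx1 hx2
    rw [hx1, Pi.smul_apply, hx2, smul_eq_mul]
  filter_upwards [h1, h2] with x hx1 hx2
  rw [hx1, Finset.sum_apply]
  simp only [hx2]
  rw [Finset.sum_eq_single (k x)]
  · rw [indicator_of_mem (by exact mem_singleton _), mul_one]
  · intro j _ hj
    have hx : x ∉ k ⁻¹' {j} := fun h => hj (Eq.symm h)
    rw [indicator_of_notMem hx, mul_zero]
  · exact fun h => absurd (Finset.mem_univ _) h

/-- Sending a point to the nearest point of a finite δ-net is measurable, with ties broken by the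
index. -/
theorem exists_measurable_index_dist_lt {E : Type*} [PseudoMetricSpace E]
    [Nonempty E] [MeasurableSpace E] [OpensMeasurableSpace E] {s : Set E}
    (hs : TotallyBounded s) {δ : ℝ} (hδ : 0 < δ) :
    ∃ (n : ℕ) (k : E → Fin n) (e : Fin n → E), Measurable k ∧ ∀ x ∈ s, dist (e (k x)) x < δ := by
  obtain ⟨t, ht, hst⟩ := Metric.totallyBounded_iff.1 hs δ hδ
  obtain ⟨e, he⟩ := countable_iff_exists_subset_range.1 ht.countable
  choose! i hi using he
  obtain ⟨n, hn⟩ := (ht.image i).bddAbove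
  -- Here n bounds the indices of the net in the enumeration e, and the nearest-point index takes
  -- the values 0, …, n.
  refine ⟨n + 1, fun x => ⟨SimpleFunc.nearestPtInd e n x,
    Nat.lt_succ_of_le (SimpleFunc.nearestPtInd_le e n x)⟩, fun j => e j, ?_, fun x hx => ?_⟩
  · refine measurable_to_countable' fun j => ?_
    convert! (SimpleFunc.nearestPtInd e n).measurableSet_preimage {(j : ℕ)} using 1
    ext x
    simp [Fin.ext_iff]
  · obtain ⟨y, hy, hxy⟩ := mem_iUnion₂.1 (hst hx)
    have h := SimpleFunc.edist_nearestPt_le e x (hn (mem_image_of_mem i hy))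
    rw [hi hy, edist_dist, edist_dist, ENNReal.ofReal_le_ofReal_iff dist_nonneg] at h
    rw [Metric.mem_ball, dist_comm] at hxy
    exact h.trans_lt hxy

variable {E : Type*} [NormedAddCommGroup E] [NormedSpace ℝ E] [FiniteDimensional ℝ E]
  [MeasurableSpace E] [BorelSpace E] {μ : Measure E} [μ.IsAddHaarMeasure]

/-- Rellich's theorem for `C¹` functions with compact support. -/
theorem totallyBounded_setOf_lintegral_fderiv_le {s : Set E} (hs : Bornology.IsBounded s)
    (hsm : MeasurableSet s) (M R : ℝ≥0) :
    TotallyBounded {f : Lp ℝ 2 (μ.restrict s) | ∃ φ : E → ℝ, ContDiff ℝ 1 φ ∧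
      HasCompactSupport φ ∧ f =ᵐ[μ.restrict s] φ ∧ ∫⁻ x, ‖φ x‖ₑ ^ 2 ∂μ ≤ M ∧
      ∫⁻ x, ‖fderiv ℝ φ x‖ₑ ^ 2 ∂μ ≤ R} := by
  have : ProperSpace E := FiniteDimensional.proper ℝ E
  refine totallyBounded_of_forall_exists_dist_le fun ε hε => ?_
  -- T and δ are chosen so that the squared error 2 ^ dim (2δ)² R of the ball averages is at most
  -- ε²; the summand 1 keeps T positive when R = 0.
  set T : ℝ := 2 ^ Module.finrank ℝ E * R + 1 with hT
  have hT0 : 0 < T := by positivity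
  set δ : ℝ := ε / (2 * √T) with hδ
  have hδ0 : 0 < δ := by positivity
  have hδε : (2 * δ) ^ 2 * T = ε ^ 2 := by
    rw [hδ]
    field_simp
    rw [Real.sq_sqrt hT0.le]
  obtain ⟨n, k, e, hk, he⟩ := exists_measurable_index_dist_lt
    (hs.isCompact_closure.totallyBounded.subset subset_closure) hδ0
  have : IsFiniteMeasure (μ.restrict s) := ⟨by simpa using hs.measure_lt_top⟩
  have hμ0 : μ (Metric.ball 0 δ) ≠ 0 := (Metric.measure_ball_pos μ 0 hδ0).ne'
  -- With the summand 1, a bound of the square by B also bounds the average itself by B.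
  set B : ℝ≥0∞ := (μ (Metric.ball 0 δ))⁻¹ * M + 1 with hB
  have hBt : B ≠ ∞ := by
    have := ENNReal.inv_ne_top.2 hμ0
    finiteness
  obtain ⟨K, hK, hKc⟩ := exists_isCompact_comp_mem (ν := μ.restrict s) hk B.toReal
  refine ⟨K, hK.totallyBounded, ?_⟩
  rintro f ⟨φ, hφ, hc, hfφ, hM, hR⟩
  obtain ⟨g, hgK, hg⟩ := hKc (fun j => ballAverage μ φ δ (e j)) fun j => by
    have h1 : ‖ballAverage μ φ δ (e j)‖ₑ ^ 2 ≤ B :=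
      (enorm_ballAverage_sq_le hφ.continuous hδ0 _).trans
        ((mul_le_mul' le_rfl hM).trans le_self_add)
    have h2 : ‖ballAverage μ φ δ (e j)‖ₑ ≤ B := by
      rcases le_total ‖ballAverage μ φ δ (e j)‖ₑ 1 with h | h
      · exact h.trans le_add_self
      · exact (le_self_pow₀ h two_ne_zero).trans h1
    have h3 := ENNReal.toReal_mono hBt h2
    rwa [toReal_enorm, Real.norm_eq_abs] at h3
  refine ⟨g, hgK, ?_⟩
  have h1 : ‖f - g‖ₑ ^ 2 ≤ ENNReal.ofReal ε ^ 2 := by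
    rw [enorm_sq_eq_lintegral]
    calc ∫⁻ x in s, ‖(f - g : Lp ℝ 2 (μ.restrict s)) x‖ₑ ^ 2 ∂μ
        = ∫⁻ x in s, ‖φ x - ballAverage μ φ δ (e (k x))‖ₑ ^ 2 ∂μ := by
          refine lintegral_congr_ae ?_
          filter_upwards [Lp.coeFn_sub f g, hfφ, hg] with x hx h1 h2
          rw [hx, Pi.sub_apply, h1, h2]
      _ ≤ ENNReal.ofReal (2 ^ Module.finrank ℝ E) * ENNReal.ofReal (2 * δ) ^ 2 * R :=
          (setLIntegral_enorm_sub_ballAverage_sq_le hφ hc hδ0 hsm he).trans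
            (mul_le_mul' le_rfl hR)
      _ ≤ ENNReal.ofReal ε ^ 2 := by
          rw [← ENNReal.ofReal_pow (by positivity), ← ENNReal.ofReal_pow hε.le,
            ← ENNReal.ofReal_coe_nnreal, ← ENNReal.ofReal_mul (by positivity),
            ← ENNReal.ofReal_mul (by positivity), ← hδε, hT]
          refine ENNReal.ofReal_le_ofReal ?_
          nlinarith [sq_nonneg (2 * δ)]
  have h2 := (ENNReal.pow_le_pow_left_iff two_ne_zero).1 h1
  rw [dist_eq_norm, ← ENNReal.ofReal_le_ofReal_iff hε.le, ofReal_norm]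
  exact h2

end TotallyBounded

/-! ### Interpolation of L⁴ between L² and L⁶ -/

section Interpolation

open scoped NNReal

instance fact_one_le_four_ennreal : Fact ((1 : ℝ≥0∞) ≤ 4) := ⟨by norm_num⟩

/-- The interpolation inequality `‖f‖₄⁴ ≤ ‖f‖₂ ‖f‖₆³`. -/
theorem eLpNorm_four_pow_four_le {α F : Type*} [MeasurableSpace α] [NormedAddCommGroup F]
    {ν : Measure α} {f : α → F} (hf : AEStronglyMeasurable f ν) :
    eLpNorm f 4 ν ^ 4 ≤ eLpNorm f 2 ν * eLpNorm f 6 ν ^ 3 := by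
  have h4 : eLpNorm f 4 ν ^ 4 = ∫⁻ x, ‖f x‖ₑ ^ 4 ∂ν := by
    have h := eLpNorm_nnreal_pow_eq_lintegral (f := f) (μ := ν) (p := 4) (by norm_num)
    simpa using h
  have h2 : eLpNorm f 2 ν ^ 2 = ∫⁻ x, ‖f x‖ₑ ^ 2 ∂ν := by
    have h := eLpNorm_nnreal_pow_eq_lintegral (f := f) (μ := ν) (p := 2) (by norm_num)
    simpa using h
  have h6 : eLpNorm f 6 ν ^ 6 = ∫⁻ x, ‖f x‖ₑ ^ 6 ∂ν := by
    have h := eLpNorm_nnreal_pow_eq_lintegral (f := f) (μ := ν) (p := 6) (by norm_num)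
    simpa using h
  -- Cauchy-Schwarz for the splitting |f|⁴ = |f| · |f|³.
  have h := ENNReal.lintegral_mul_le_Lp_mul_Lq ν Real.HolderConjugate.two_two hf.enorm
    (hf.enorm.pow_const 3)
  have e1 : ∀ x, ‖f x‖ₑ * ‖f x‖ₑ ^ 3 = ‖f x‖ₑ ^ 4 := fun x => by ring
  have e2 : ∀ x, (‖f x‖ₑ ^ 3) ^ (2 : ℝ) = ‖f x‖ₑ ^ 6 := fun x => by
    rw [ENNReal.rpow_two]; ring
  simp only [Pi.mul_apply, e1, e2, ENNReal.rpow_two] at h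
  rw [← h4, ← h2, ← h6] at h
  have e3 : eLpNorm f 6 ν ^ 6 = (eLpNorm f 6 ν ^ 3) ^ 2 := by ring
  rw [e3, ← ENNReal.rpow_two, ← ENNReal.rpow_two, ← ENNReal.rpow_mul, ← ENNReal.rpow_mul] at h
  norm_num at h
  exact h

end Interpolation

/-! ### The compact embedding of H₀¹(Ω) in L⁴(Ω) -/

namespace BoundedDomain

open scoped NNReal

variable {N : ℕ}

theorem isFiniteMeasure_measure (Ω : BoundedDomain N) : IsFiniteMeasure Ω.measure :=
  ⟨by simpa using Ω.isBounded.measure_lt_top⟩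

theorem enorm_gradient (φ : EuclideanSpace ℝ (Fin N) → ℝ) (x : EuclideanSpace ℝ (Fin N)) :
    ‖∇ φ x‖ₑ = ‖fderiv ℝ φ x‖ₑ := by
  rw [← ofReal_norm, ← ofReal_norm, gradient, LinearIsometryEquiv.norm_map]

theorem exists_test_of_mem_testPairs {Ω : BoundedDomain N} {p : Ω.L2Pair} (hp : p ∈ Ω.testPairs) :
    ∃ φ : EuclideanSpace ℝ (Fin N) → ℝ, ContDiff ℝ 1 φ ∧ HasCompactSupport φ ∧
      tsupport φ ⊆ Ω.carrier ∧ p.1 =ᵐ[Ω.measure] φ ∧ p.2 =ᵐ[Ω.measure] ∇ φ := by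
  obtain ⟨φ, h1, h2⟩ := hp
  exact ⟨φ, φ.contDiff.of_le (by simp), φ.hasCompactSupport, φ.tsupport_subset, h1, h2⟩

theorem lintegral_enorm_fderiv_sq_eq {Ω : BoundedDomain N} {p : Ω.L2Pair}
    {φ : EuclideanSpace ℝ (Fin N) → ℝ} (hsub : tsupport φ ⊆ Ω.carrier)
    (h : p.2 =ᵐ[Ω.measure] ∇ φ) : ∫⁻ x, ‖fderiv ℝ φ x‖ₑ ^ 2 = ‖p.2‖ₑ ^ 2 := by
  rw [enorm_sq_eq_lintegral, ← setLIntegral_eq_of_support_subset (s := Ω.carrier)]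
  · refine lintegral_congr_ae ?_
    filter_upwards [h] with x hx
    rw [hx, enorm_gradient]
  · intro x hx
    refine hsub (tsupport_fderiv_subset ℝ (subset_tsupport _ ?_))
    rw [Function.mem_support] at hx ⊢
    contrapose! hx
    simp [hx, ← ofReal_norm]

theorem lintegral_enorm_sq_eq {Ω : BoundedDomain N} {p : Ω.L2Pair}
    {φ : EuclideanSpace ℝ (Fin N) → ℝ} (hsub : tsupport φ ⊆ Ω.carrier)
    (h : p.1 =ᵐ[Ω.measure] φ) : ∫⁻ x, ‖φ x‖ₑ ^ 2 = ‖p.1‖ₑ ^ 2 := by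
  rw [enorm_sq_eq_lintegral, ← setLIntegral_eq_of_support_subset (s := Ω.carrier)]
  · refine lintegral_congr_ae ?_
    filter_upwards [h] with x hx
    rw [hx]
  · intro x hx
    refine hsub (subset_tsupport _ ?_)
    rw [Function.mem_support] at hx ⊢
    contrapose! hx
    simp [hx]

/-- Sobolev inequality in `H₀¹(Ω)`. -/
theorem exists_eLpNorm_six_le [NeZero N] (hN : N ≤ 3) (Ω : BoundedDomain N) :
    ∃ C : ℝ≥0, ∀ u : Ω.H01, eLpNorm (H01.val u) 6 Ω.measure ≤ C * ‖H01.grad u‖ₑ := by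
  obtain ⟨C, hC⟩ := exists_sobolev_six hN Ω.isBounded
  have htest : ∀ p ∈ Ω.testPairs, eLpNorm p.1 6 Ω.measure ≤ C * ‖p.2‖ₑ := by
    intro p hp
    obtain ⟨φ, hφ, hc, hsub, h1, h2⟩ := exists_test_of_mem_testPairs hp
    have h3 : eLpNorm (fderiv ℝ φ) 2 volume = ‖p.2‖ₑ := by
      have h := eLpNorm_nnreal_pow_eq_lintegral (f := fderiv ℝ φ) (p := 2)
        (μ := (volume : Measure (EuclideanSpace ℝ (Fin N)))) (by norm_num)
      have h' : eLpNorm (fderiv ℝ φ) 2 volume ^ 2 = ‖p.2‖ₑ ^ 2 := by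
        rw [← lintegral_enorm_fderiv_sq_eq hsub h2]
        simpa using h
      exact (ENNReal.pow_right_strictMono two_ne_zero).injective h'
    rw [eLpNorm_congr_ae h1,
      eLpNorm_restrict_eq_of_support_subset ((subset_tsupport φ).trans hsub), ← h3]
    exact hC φ hφ hc hsub
  refine ⟨C, fun u => ?_⟩
  obtain ⟨p, hp, hpu⟩ := mem_closure_iff_seq_limit.1 u.2
  have hp1 : Tendsto (fun n => (p n).1) atTop (𝓝 (H01.val u)) :=
    (continuous_fst.tendsto _).comp hpu
  have hp2 : Tendsto (fun n => (p n).2) atTop (𝓝 (H01.grad u)) :=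
    (continuous_snd.tendsto _).comp hpu
  -- Approximation in H¹ does not yet give convergence in L⁶, but Fatou's lemma along an a.e.
  -- convergent subsequence suffices for the upper bound.
  obtain ⟨ns, hns, hae⟩ := (tendstoInMeasure_of_tendsto_Lp hp1).exists_seq_tendsto_ae
  refine (Lp.eLpNorm_lim_le_liminf_eLpNorm (fun n => Lp.aestronglyMeasurable _) _ hae).trans ?_
  have hlim : Tendsto (fun n => (C : ℝ≥0∞) * ‖(p (ns n)).2‖ₑ) atTop (𝓝 (C * ‖H01.grad u‖ₑ)) :=
    ENNReal.Tendsto.const_mul ((continuous_enorm.tendsto _).comp (hp2.comp hns.tendsto_atTop))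
      (Or.inr ENNReal.coe_ne_top)
  rw [← hlim.liminf_eq]
  exact liminf_le_liminf (.of_forall fun n => htest _ (hp _))

/-- Rellich's theorem: bounded subsets of `H₀¹(Ω)` are totally bounded in `L²(Ω)`. -/
theorem totallyBounded_val_image (Ω : BoundedDomain N) (R : ℝ) :
    TotallyBounded (H01.val '' {u : Ω.H01 | ‖u‖ ≤ R}) := by
  have htb := totallyBounded_setOf_lintegral_fderiv_le (μ := volume) Ω.isBounded
    Ω.isOpen.measurableSet ((R + 1).toNNReal ^ 2) ((R + 1).toNNReal ^ 2)
  refine htb.closure.subset ?_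
  rintro _ ⟨u, hu, rfl⟩
  refine Metric.mem_closure_iff.2 fun ε hε => ?_
  -- Closeness within 1 keeps the approximating test pair in the ball of radius R + 1, for which
  -- `htb` was set up.
  obtain ⟨p, hp, hpu⟩ := Metric.mem_closure_iff.1 u.2 (min ε 1) (by positivity)
  refine ⟨p.1, ?_, ((le_max_left _ _).trans_lt hpu).trans_le (min_le_left _ _)⟩
  have hpR : ‖p‖ ≤ R + 1 := by
    have h1 : ‖p‖ ≤ ‖(u : Ω.L2Pair)‖ + dist (u : Ω.L2Pair) p := by
      rw [dist_eq_norm, norm_sub_rev]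
      linarith [norm_le_norm_add_norm_sub' p (u : Ω.L2Pair)]
    have h2 : ‖(u : Ω.L2Pair)‖ ≤ R := hu
    linarith [hpu.le.trans (min_le_right ε 1)]
  obtain ⟨φ, hφ, hc, hsub, h1, h2⟩ := exists_test_of_mem_testPairs hp
  refine ⟨φ, hφ, hc, h1, ?_, ?_⟩
  · rw [lintegral_enorm_sq_eq hsub h1, ENNReal.coe_pow, ← ofReal_norm]
    gcongr
    exact ENNReal.ofReal_le_ofReal ((norm_fst_le p).trans hpR)
  · rw [lintegral_enorm_fderiv_sq_eq hsub h2, ENNReal.coe_pow, ← ofReal_norm]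
    gcongr
    exact ENNReal.ofReal_le_ofReal ((norm_snd_le p).trans hpR)

/-- The compact embedding of `H₀¹(Ω)` in `L⁴(Ω)`. -/
theorem exists_embedding_four [NeZero N] (hN : N ≤ 3) (Ω : BoundedDomain N) :
    ∃ T : Ω.H01 →L[ℝ] Lp ℝ 4 Ω.measure, (∀ u, T u =ᵐ[Ω.measure] H01.val u) ∧
      ∀ R, TotallyBounded (T '' {u : Ω.H01 | ‖u‖ ≤ R}) := by
  obtain ⟨C, hC⟩ := exists_eLpNorm_six_le hN Ω
  have := isFiniteMeasure_measure Ω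
  have hmem : ∀ u : Ω.H01, MemLp (H01.val u) 4 Ω.measure := fun u =>
    MemLp.mono_exponent (q := 6) ⟨Lp.aestronglyMeasurable _,
      (hC u).trans_lt (ENNReal.mul_lt_top ENNReal.coe_lt_top enorm_lt_top)⟩ (by norm_num)
  let T₀ : Ω.H01 →ₗ[ℝ] Lp ℝ 4 Ω.measure :=
    { toFun := fun u => (hmem u).toLp
      map_add' := fun u v => by
        rw [← MemLp.toLp_add]
        exact MemLp.toLp_congr _ _ (Lp.coeFn_add _ _)
      map_smul' := fun c u => by
        rw [RingHom.id_apply, ← MemLp.toLp_const_smul]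
        exact MemLp.toLp_congr _ _ (Lp.coeFn_smul _ _) }
  have hT₀ : ∀ u, T₀ u =ᵐ[Ω.measure] H01.val u := fun u => (hmem u).coeFn_toLp
  have hint : ∀ u : Ω.H01, ‖T₀ u‖ ^ 4 ≤ ‖H01.val u‖ * (C * ‖u‖) ^ 3 := by
    intro u
    have h1 := eLpNorm_four_pow_four_le (Lp.aestronglyMeasurable (H01.val u))
    have h2 : eLpNorm (H01.val u) 6 Ω.measure ≤ C * ‖u‖ₑ :=
      (hC u).trans (mul_le_mul' le_rfl
        (enorm_le_iff_norm_le.2 (norm_snd_le (u : Ω.L2Pair))))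
    rw [← eLpNorm_congr_ae (hT₀ u), ← Lp.enorm_def, ← Lp.enorm_def] at h1
    have h3 := ENNReal.toReal_mono (by finiteness) (h1.trans (mul_le_mul' le_rfl
      (pow_le_pow_left' h2 3)))
    simpa using h3
  have hbound : ∀ u : Ω.H01, ‖T₀ u‖ ≤ (C + 1) * ‖u‖ := by
    intro u
    have h1 : ‖H01.val u‖ ≤ ‖u‖ := norm_fst_le (u : Ω.L2Pair)
    refine le_of_pow_le_pow_left₀ (n := 4) (by norm_num) (by positivity) ((hint u).trans ?_)
    calc ‖H01.val u‖ * (C * ‖u‖) ^ 3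
        ≤ ((C + 1) * ‖u‖) * ((C + 1) * ‖u‖) ^ 3 := by
          gcongr
          · exact h1.trans (le_mul_of_one_le_left (norm_nonneg _) (by simp))
          · simp
      _ = ((C + 1) * ‖u‖) ^ 4 := by ring
  refine ⟨T₀.mkContinuous (C + 1) hbound, hT₀, fun R => Metric.totallyBounded_iff.2 fun ε hε => ?_⟩
  -- By `hint`, an L² distance below η between elements of norm at most R forces an L⁴ distance
  -- below ε: an L² net becomes an L⁴ net.
  set η := ε ^ 4 / ((C * (2 * |R|)) ^ 3 + 1) with hη
  have hη0 : 0 < η := by positivity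
  obtain ⟨t, hts, htf, htc⟩ := Metric.finite_approx_of_totallyBounded (totallyBounded_val_image Ω R)
    η hη0
  obtain ⟨t', ht's, ht'f, rfl⟩ := exists_subset_image_finite_and.1 ⟨t, hts, htf, rfl⟩
  refine ⟨T₀ '' t', ht'f.image _, ?_⟩
  rintro _ ⟨u, hu, rfl⟩
  obtain ⟨_, ⟨v, hv, rfl⟩, huv⟩ := mem_iUnion₂.1 (htc (mem_image_of_mem _ hu))
  refine mem_iUnion₂.2 ⟨T₀ v, mem_image_of_mem _ hv, ?_⟩
  rw [Metric.mem_ball, dist_eq_norm] at huv ⊢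
  have hu' : ‖u‖ ≤ R := hu
  have hv' : ‖v‖ ≤ R := ht's hv
  have h1 : ‖u - v‖ ≤ 2 * |R| := by
    linarith [norm_sub_le u v, le_abs_self R]
  change ‖T₀ u - T₀ v‖ < ε
  rw [← map_sub]
  refine lt_of_pow_lt_pow_left₀ 4 hε.le ((hint _).trans_lt ?_)
  calc ‖H01.val (u - v)‖ * (C * ‖u - v‖) ^ 3 ≤ η * (C * (2 * |R|)) ^ 3 := by
        gcongr; exact huv.le
    _ < η * ((C * (2 * |R|)) ^ 3 + 1) := by gcongr; linarith
    _ = ε ^ 4 := by rw [hη]; field_simp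

end BoundedDomain

/-! ### Coercivity of the coupling matrix on Gram matrices -/

section GramCoercivity

variable {V : Type*} [NormedAddCommGroup V] [InnerProductSpace ℝ V] {m : ℕ}

theorem sum_conjTranspose_mul_self_inner (B : Matrix (Fin m) (Fin m) ℝ) (v : Fin m → V) :
    ∑ i, ∑ j, (B.conjTranspose * B) i j * inner ℝ (v i) (v j) = ∑ k, ‖∑ i, B k i • v i‖ ^ 2 := by
  simp only [← real_inner_self_eq_norm_sq, sum_inner, inner_sum, real_inner_smul_left,
    real_inner_smul_right, Matrix.mul_apply, Matrix.conjTranspose_apply, star_trivial,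
    Finset.sum_mul]
  rw [Finset.sum_congr rfl fun x _ => Finset.sum_comm, Finset.sum_comm]
  refine Finset.sum_congr rfl fun k _ => ?_
  rw [Finset.sum_comm]
  refine Finset.sum_congr rfl fun i _ => Finset.sum_congr rfl fun j _ => ?_
  rw [real_inner_comm]
  ring

open scoped MatrixOrder Matrix.Norms.L2Operator in
theorem exists_isUnit_eq_conjTranspose_mul_self {g : Matrix (Fin m) (Fin m) ℝ} (hg : g.PosDef) :
    ∃ B : Matrix (Fin m) (Fin m) ℝ, IsUnit B ∧ g = B.conjTranspose * B :=
  CStarAlgebra.isStrictlyPositive_iff_eq_star_mul_self.1 hg.isStrictlyPositive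

/-- Factor g = BᵀB with B invertible. The form equals ∑ ‖wₖ‖² for w = Bv, and v = B⁻¹w is bounded by
w through Cauchy-Schwarz. -/
theorem exists_le_gram_of_posDef {g : Matrix (Fin m) (Fin m) ℝ} (hg : g.PosDef) :
    ∃ c : ℝ, 0 < c ∧ ∀ (v : Fin m → V) (i : Fin m),
      c * ‖v i‖ ^ 2 ≤ ∑ i, ∑ j, g i j * inner ℝ (v i) (v j) := by
  obtain ⟨B, hB, rfl⟩ := exists_isUnit_eq_conjTranspose_mul_self hg
  have hdet := (Matrix.isUnit_iff_isUnit_det B).1 hB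
  set K := ∑ i, ∑ k, (B⁻¹ i k) ^ 2 with hK
  have hK0 : 0 ≤ K := by positivity
  refine ⟨(K + 1)⁻¹, by positivity, fun v i => ?_⟩
  rw [sum_conjTranspose_mul_self_inner, inv_mul_le_iff₀ (by positivity)]
  set w : Fin m → V := fun k => ∑ i, B k i • v i with hw
  have hv : v i = ∑ k, B⁻¹ i k • w k := by
    simp only [hw, Finset.smul_sum, smul_smul]
    rw [Finset.sum_comm]
    simp only [← Finset.sum_smul, ← Matrix.mul_apply, Matrix.nonsing_inv_mul B hdet,
      Matrix.one_apply]
    simp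
  have h1 : ‖v i‖ ≤ ∑ k, |B⁻¹ i k| * ‖w k‖ := by
    rw [hv]
    refine (norm_sum_le _ _).trans_eq ?_
    simp [norm_smul]
  have h2 : K ≥ ∑ k, (B⁻¹ i k) ^ 2 :=
    Finset.single_le_sum (f := fun i => ∑ k, (B⁻¹ i k) ^ 2) (fun i _ => by positivity)
      (Finset.mem_univ i)
  calc ‖v i‖ ^ 2 ≤ (∑ k, |B⁻¹ i k| * ‖w k‖) ^ 2 := by gcongr
    _ ≤ (∑ k, |B⁻¹ i k| ^ 2) * ∑ k, ‖w k‖ ^ 2 := Finset.sum_mul_sq_le_sq_mul_sq _ _ _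
    _ ≤ (K + 1) * ∑ k, ‖w k‖ ^ 2 := by
      gcongr
      simp only [sq_abs]
      linarith

/-- If all entries are positive, every term is nonnegative and the diagonal one can be kept alone.
The sign condition on the inner products is met by the squares vᵢ = xᵢ², to which this is applied.
-/
theorem exists_le_gram {g : Matrix (Fin m) (Fin m) ℝ} (hg : (∀ i j, 0 < g i j) ∨ g.PosDef) :
    ∃ c : ℝ, 0 < c ∧ ∀ v : Fin m → V, (∀ i j, 0 ≤ inner ℝ (v i) (v j)) → ∀ i,
      c * ‖v i‖ ^ 2 ≤ ∑ i, ∑ j, g i j * inner ℝ (v i) (v j) := by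
  rcases hg with hg | hg
  · have hc : ∃ c : ℝ, 0 < c ∧ ∀ i, c ≤ g i i := by
      rcases isEmpty_or_nonempty (Fin m) with h | h
      · exact ⟨1, one_pos, fun i => isEmptyElim i⟩
      · obtain ⟨i, hi⟩ := Finite.exists_min fun i => g i i
        exact ⟨g i i, hg i i, hi⟩
    obtain ⟨c, hc0, hc⟩ := hc
    refine ⟨c, hc0, fun v hv i => ?_⟩
    have h0 : ∀ i j, 0 ≤ g i j * inner ℝ (v i) (v j) := fun i j => mul_nonneg (hg i j).le (hv i j)
    calc c * ‖v i‖ ^ 2 ≤ g i i * inner ℝ (v i) (v i) := by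
          rw [real_inner_self_eq_norm_sq]; gcongr; exact hc i
      _ ≤ ∑ j, g i j * inner ℝ (v i) (v j) :=
          Finset.single_le_sum (f := fun j => g i j * inner ℝ (v i) (v j)) (fun j _ => h0 i j)
            (Finset.mem_univ i)
      _ ≤ _ := Finset.single_le_sum (f := fun i => ∑ j, g i j * inner ℝ (v i) (v j))
            (fun i _ => Finset.sum_nonneg fun j _ => h0 i j) (Finset.mem_univ i)
  · obtain ⟨c, hc0, hc⟩ := exists_le_gram_of_posDef (V := V) hg
    exact ⟨c, hc0, fun v _ i => hc v i⟩

end GramCoercivity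

/-! ### The potential and quartic forms on L⁴(Ω; ℝᵐ) -/

section LpFour

variable {α : Type*} [MeasurableSpace α] {ν : Measure α} {m : ℕ}

instance holderTriple_four_four_two : ENNReal.HolderTriple 4 4 2 where
  inv_add_inv_eq_inv := by
    rw [← two_mul, show (4 : ℝ≥0∞) = 2 * 2 by norm_num,
      ENNReal.mul_inv (Or.inl two_ne_zero) (Or.inl (by simp)), ← mul_assoc,
      ENNReal.mul_inv_cancel two_ne_zero (by simp), one_mul]

variable (ν) in
/-- Multiplication `L⁴ × L⁴ → L²`. -/
def mulFour : Lp ℝ 4 ν →L[ℝ] Lp ℝ 4 ν →L[ℝ] Lp ℝ 2 ν :=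
  (ContinuousLinearMap.mul ℝ ℝ).holderL ν 4 4 2

theorem coeFn_mulFour (x y : Lp ℝ 4 ν) : mulFour ν x y =ᵐ[ν] fun t => x t * y t :=
  (ContinuousLinearMap.mul ℝ ℝ).coeFn_holder x y

theorem mulFour_comm (x y : Lp ℝ 4 ν) : mulFour ν x y = mulFour ν y x := by
  refine Lp.ext ?_
  filter_upwards [coeFn_mulFour x y, coeFn_mulFour y x] with t h1 h2
  rw [h1, h2, mul_comm]

/-- This turns coercivity in the L² norms of the squares xᵢ² into coercivity of degree four in L⁴.
-/
theorem norm_mulFour_self (x : Lp ℝ 4 ν) : ‖mulFour ν x x‖ = ‖x‖ ^ 2 := by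
  have h4 : eLpNorm x 4 ν ^ 4 = ∫⁻ t, ‖x t‖ₑ ^ 4 ∂ν := by
    have h := eLpNorm_nnreal_pow_eq_lintegral (f := x) (μ := ν) (p := 4) (by norm_num)
    simpa using h
  have h : ‖mulFour ν x x‖ₑ ^ 2 = (‖x‖ₑ ^ 2) ^ 2 := by
    rw [← pow_mul, Lp.enorm_def x, h4, enorm_sq_eq_lintegral]
    refine lintegral_congr_ae ?_
    filter_upwards [coeFn_mulFour x x] with t ht
    rw [ht, enorm_mul]
    ring
  have h' := (ENNReal.pow_right_strictMono two_ne_zero).injective h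
  simpa using congrArg ENNReal.toReal h'

theorem inner_mulFour_self_nonneg (x y : Lp ℝ 4 ν) :
    0 ≤ inner ℝ (mulFour ν x x) (mulFour ν y y) := by
  rw [L2.inner_def]
  refine integral_nonneg_of_ae ?_
  filter_upwards [coeFn_mulFour x x, coeFn_mulFour y y] with t h1 h2
  rw [h1, h2]
  simp only [Pi.zero_apply, RCLike.inner_apply, conj_trivial]
  exact mul_nonneg (mul_self_nonneg _) (mul_self_nonneg _)

variable (ν) in
/-- The form `(x, y) ↦ ∑ᵢ ∫ aᵢ xᵢ yᵢ`. -/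
def potentialForm (a : Fin m → Lp ℝ 2 ν) :
    (Fin m → Lp ℝ 4 ν) →L[ℝ] (Fin m → Lp ℝ 4 ν) →L[ℝ] ℝ :=
  ∑ i, ((ContinuousLinearMap.compL ℝ (Lp ℝ 4 ν) (Lp ℝ 2 ν) ℝ (innerSL ℝ (a i))).comp
    (mulFour ν)).bilinearComp (ContinuousLinearMap.proj i) (ContinuousLinearMap.proj i)

theorem potentialForm_apply (a : Fin m → Lp ℝ 2 ν) (x y : Fin m → Lp ℝ 4 ν) :
    potentialForm ν a x y = ∑ i, inner ℝ (a i) (mulFour ν (x i) (y i)) := by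
  simp [potentialForm]

theorem potentialForm_comm (a : Fin m → Lp ℝ 2 ν) (x y : Fin m → Lp ℝ 4 ν) :
    potentialForm ν a x y = potentialForm ν a y x := by
  simp only [potentialForm_apply, mulFour_comm]

/-- The functional `y ↦ ∑ᵢⱼ gᵢⱼ ∫ xᵢ yᵢ xⱼ²`. -/
def quarticForm (g : Matrix (Fin m) (Fin m) ℝ) (x : Fin m → Lp ℝ 4 ν) :
    (Fin m → Lp ℝ 4 ν) →L[ℝ] ℝ :=
  ∑ i, ∑ j, g i j • ((innerSL ℝ (mulFour ν (x j) (x j))).comp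
    ((mulFour ν (x i)).comp (ContinuousLinearMap.proj i)))

theorem quarticForm_apply (g : Matrix (Fin m) (Fin m) ℝ) (x y : Fin m → Lp ℝ 4 ν) :
    quarticForm g x y =
      ∑ i, ∑ j, g i j * inner ℝ (mulFour ν (x j) (x j)) (mulFour ν (x i) (y i)) := by
  simp [quarticForm]

theorem continuous_quarticForm (g : Matrix (Fin m) (Fin m) ℝ) :
    Continuous (quarticForm (ν := ν) g) := by
  unfold quarticForm
  fun_prop

theorem quarticForm_self (g : Matrix (Fin m) (Fin m) ℝ) (x : Fin m → Lp ℝ 4 ν) :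
    quarticForm g x x =
      ∑ i, ∑ j, g i j * inner ℝ (mulFour ν (x i) (x i)) (mulFour ν (x j) (x j)) := by
  simp only [quarticForm_apply, real_inner_comm]

theorem hasFDerivAt_quarticForm_self {g : Matrix (Fin m) (Fin m) ℝ} (hg : g.IsSymm)
    (x : Fin m → Lp ℝ 4 ν) :
    HasFDerivAt (fun x => quarticForm g x x) ((4 : ℝ) • quarticForm g x) x := by
  simp only [quarticForm_self]
  have hS : ∀ i, HasFDerivAt (fun x : Fin m → Lp ℝ 4 ν => mulFour ν (x i) (x i))
      ((2 : ℝ) • (mulFour ν (x i)).comp (ContinuousLinearMap.proj i)) x := by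
    intro i
    let π : (Fin m → Lp ℝ 4 ν) →L[ℝ] Lp ℝ 4 ν := ContinuousLinearMap.proj i
    have h := (mulFour ν).isBoundedBilinearMap.hasFDerivAt (x i, x i)
    refine (h.comp x (π.hasFDerivAt.prodMk π.hasFDerivAt)).congr_fderiv ?_
    ext1 ξ
    simp [π, IsBoundedBilinearMap.deriv, mulFour_comm (ξ i), two_smul]
  have h := HasFDerivAt.fun_sum (u := Finset.univ) fun i _ =>
    HasFDerivAt.fun_sum (u := Finset.univ) fun j _ => ((hS i).inner ℝ (hS j)).const_mul (g i j)
  refine h.congr_fderiv ?_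
  ext1 ξ
  simp only [sum_apply, smul_apply, quarticForm_apply]
  simp only [ContinuousLinearMap.comp_apply, ContinuousLinearMap.prod_apply, fderivInnerCLM_apply,
    smul_apply, ContinuousLinearMap.proj_apply, real_inner_smul_left, real_inner_smul_right,
    smul_eq_mul, mul_add, Finset.sum_add_distrib]
  -- The product rule gives two double sums, each with a factor 2. Exchanging i and j in one of them
  -- and using the symmetry of g makes them equal, hence the factor 4.
  rw [Finset.sum_comm, ← Finset.sum_add_distrib, Finset.mul_sum]
  refine Finset.sum_congr rfl fun i _ => ?_
  rw [← Finset.sum_add_distrib, Finset.mul_sum]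
  refine Finset.sum_congr rfl fun j _ => ?_
  rw [hg.apply i j, real_inner_comm (mulFour ν (x j) (x j))]
  ring

theorem exists_le_quarticForm_self {g : Matrix (Fin m) (Fin m) ℝ}
    (hg : (∀ i j, 0 < g i j) ∨ g.PosDef) :
    ∃ c : ℝ, 0 < c ∧ ∀ x : Fin m → Lp ℝ 4 ν, c * ‖x‖ ^ 4 ≤ quarticForm g x x := by
  obtain ⟨c, hc0, hc⟩ := exists_le_gram (V := Lp ℝ 2 ν) hg
  refine ⟨c, hc0, fun x => ?_⟩
  have h := hc (fun i => mulFour ν (x i) (x i)) fun i j => inner_mulFour_self_nonneg _ _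
  simp only [norm_mulFour_self, ← pow_mul, ← quarticForm_self] at h
  rcases isEmpty_or_nonempty (Fin m) with hm | hm
  · simp [quarticForm_self, Subsingleton.elim x 0]
  -- The norm on the product is the maximum of the component norms, so one well-chosen component is
  -- enough.
  · obtain ⟨i, hi⟩ := Finite.exists_max fun i => ‖x i‖
    have h1 : ‖x‖ ≤ ‖x i‖ := (pi_norm_le_iff_of_nonneg (norm_nonneg _)).2 hi
    refine le_trans ?_ (h i)
    gcongr

end LpFour

/-! ### The system space and its energy in abstract form -/

namespace SystemSpace

variable {N m : ℕ} [NeZero N] {Ω : BoundedDomain N} {ε : Fin m → Ioi (0 : ℝ)}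

/-- The compact embedding of the system space in `L⁴(Ω; ℝᵐ)`. -/
theorem exists_embedding_four (hN : N ≤ 3) (Ω : BoundedDomain N) (ε : Fin m → Ioi (0 : ℝ)) :
    ∃ J : SystemSpace Ω ε →L[ℝ] (Fin m → Lp ℝ 4 Ω.measure),
      (∀ u i, J u i =ᵐ[Ω.measure] u.comp i) ∧
      ∀ (R : ℝ) (u : ℕ → SystemSpace Ω ε), (∀ n, ‖u n‖ ≤ R) →
        ∃ (x : Fin m → Lp ℝ 4 Ω.measure) (φ : ℕ → ℕ), StrictMono φ ∧
          Tendsto (fun n => J (u (φ n))) atTop (𝓝 x) := by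
  obtain ⟨e, he⟩ := exists_equiv_prod Ω ε
  obtain ⟨T, hT, hTc⟩ := BoundedDomain.exists_embedding_four hN Ω
  refine ⟨ContinuousLinearMap.pi fun i =>
    T.comp ((ContinuousLinearMap.proj i).comp (e : SystemSpace Ω ε →L[ℝ] (Fin m → Ω.H01))),
    fun u i => ?_, fun R u hu => ?_⟩
  · have h : T (e u i) = T (u i) := congrArg T (he u i)
    change T (e u i) =ᵐ[Ω.measure] H01.val (u i)
    rw [h]
    exact hT (u i)
  · set K := closure (T '' {v : Ω.H01 | ‖v‖ ≤ ‖(e : SystemSpace Ω ε →L[ℝ] (Fin m → Ω.H01))‖ * R})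
    have hK : IsCompact K := 
      isCompact_iff_totallyBounded_isComplete.2 ⟨(hTc _).closure, isClosed_closure.isComplete⟩
    -- Compactness of the product extracts one subsequence for all components at once.
    have hKpi : IsCompact (Set.pi univ fun _ : Fin m => K) := isCompact_univ_pi fun _ => hK
    have hmem : ∀ n, (fun i => T (e (u n) i)) ∈ Set.pi univ fun _ : Fin m => K := fun n i _ =>
      subset_closure (mem_image_of_mem _ ((norm_le_pi_norm (e (u n)) i).trans
        (((e : SystemSpace Ω ε →L[ℝ] (Fin m → Ω.H01)).le_opNorm (u n)).trans
          (by gcongr; exact hu n))))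
    obtain ⟨x, -, φ, hφ, hx⟩ := hKpi.tendsto_subseq hmem
    exact ⟨x, φ, hφ, hx⟩

/-- With uᵢ² in L², both the potential term and the quartic term become L² inner products; this is
why the potentials enter as elements of L². -/
theorem energy_eq_quarticEnergy {a : Fin m → EuclideanSpace ℝ (Fin N) → ℝ}
    {g : Matrix (Fin m) (Fin m) ℝ} {a' : Fin m → Lp ℝ 2 Ω.measure}
    (ha : ∀ i, a' i =ᵐ[Ω.measure] a i) {J : SystemSpace Ω ε →L[ℝ] (Fin m → Lp ℝ 4 Ω.measure)}
    (hJ : ∀ u i, J u i =ᵐ[Ω.measure] u.comp i) :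
    energy a g = quarticEnergy J (potentialForm Ω.measure a') (quarticForm g) := by
  funext u
  have hsq : ∀ i, mulFour Ω.measure (J u i) (J u i) =ᵐ[Ω.measure] fun x => |u.comp i x| ^ 2 := by
    intro i
    filter_upwards [coeFn_mulFour (J u i) (J u i), hJ u i] with x h1 h2
    rw [h1, h2, sq_abs, sq]
  have h1 : ∫ x, ∑ i, ((ε i : ℝ) * ‖u.grad i x‖ ^ 2 + a i x * |u.comp i x| ^ 2) ∂Ω.measure
      = inner ℝ u u + potentialForm Ω.measure a' (J u) (J u) := by
    have hin : inner ℝ u u = ∑ i, (ε i : ℝ) * inner ℝ (u.grad i) (u.grad i) := innerH_eq_sum u u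
    have hi1 : ∀ i, Integrable (fun x => (ε i : ℝ) * inner ℝ (u.grad i x) (u.grad i x)) Ω.measure :=
      fun i => (L2.integrable_inner _ _).const_mul _
    have hi2 : ∀ i, Integrable (fun x => inner ℝ (a' i x)
        (mulFour Ω.measure (J u i) (J u i) x)) Ω.measure := fun i => L2.integrable_inner _ _
    rw [potentialForm_apply, hin, ← Finset.sum_add_distrib]
    simp only [L2.inner_def, ← integral_const_mul]
    rw [Finset.sum_congr rfl fun i _ => (integral_add (hi1 i) (hi2 i)).symm]
    refine Eq.trans (integral_congr_ae ?_)
      (integral_finsetSum Finset.univ fun i _ => (hi1 i).add (hi2 i))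
    filter_upwards [ae_all_iff.2 hsq, ae_all_iff.2 ha] with x hx hax
    refine Finset.sum_congr rfl fun i _ => ?_
    rw [hx, hax, real_inner_self_eq_norm_sq, RCLike.inner_apply, conj_trivial, mul_comm (a i x)]
  have h2 : ∫ x, ∑ i, ∑ j, g i j * |u.comp i x| ^ 2 * |u.comp j x| ^ 2 ∂Ω.measure
      = quarticForm g (J u) (J u) := by
    rw [quarticForm_self]
    simp only [L2.inner_def, ← integral_const_mul]
    rw [integral_congr_ae (g := fun x => ∑ i, ∑ j, g i j * inner ℝ
      (mulFour Ω.measure (J u i) (J u i) x) (mulFour Ω.measure (J u j) (J u j) x))]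
    · have hint : ∀ i j, Integrable (fun x => g i j * inner ℝ
          (mulFour Ω.measure (J u i) (J u i) x) (mulFour Ω.measure (J u j) (J u j) x)) Ω.measure :=
        fun i j => (L2.integrable_inner _ _).const_mul _
      rw [integral_finsetSum _ fun i _ => integrable_finsetSum _ fun j _ => hint i j]
      exact Finset.sum_congr rfl fun i _ => integral_finsetSum _ fun j _ => hint i j
    · filter_upwards [ae_all_iff.2 hsq] with x hx
      refine Finset.sum_congr rfl fun i _ => Finset.sum_congr rfl fun j _ => ?_
      rw [hx, hx, RCLike.inner_apply, conj_trivial]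
      ring
  rw [energy, quarticEnergy, h1, h2]

end SystemSpace

end

/-! ### The Palais-Smale condition for the system -/

theorem lemma2p4 {N m : ℕ} [NeZero N] (hN : N ≤ 3) (Ω : BoundedDomain N)
    (ε : Fin m → Set.Ioi (0 : ℝ))
    (g : Matrix (Fin m) (Fin m) ℝ) (hsymm : g.IsSymm)
    (hg : (∀ i j, 0 < g i j) ∨ g.PosDef)
    (a : Fin m → EuclideanSpace ℝ (Fin N) → ℝ)
    (ha : ∀ i, MemLp (a i) ∞ Ω.measure)
    (ha_lower : ∀ i, ∀ᵐ x ∂Ω.measure, -Ω.firstDirichletEigenvalue < a i x)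
    (E : SystemSpace Ω ε → ℝ) (hE : E = SystemSpace.energy a g)
    (u : ℕ → SystemSpace Ω ε) (hu : ∀ n, u n ∈ SystemSpace.nehariManifold E)
    (hbdd : ∃ C : ℝ, ∀ n, |E (u n)| ≤ C)
    (hgrad : Tendsto (fun n => ‖SystemSpace.riemannianGradient E (u n)‖) atTop (𝓝 0)) :
    ∃ (v : SystemSpace Ω ε) (φ : ℕ → ℕ), StrictMono φ ∧ Tendsto (u ∘ φ) atTop (𝓝 v) := by
  -- `ha_lower` is not needed: on the Nehari manifold the quartic term equals `4 E`, so it bounds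
  -- the `L⁴` norm, and this bounds the `H` norm since each `a i` is bounded.
  have := Ω.isFiniteMeasure_measure
  have ha2 : ∀ i, MemLp (a i) 2 Ω.measure := fun i => (ha i).mono_exponent le_top
  obtain ⟨J, hJ, hJc⟩ := SystemSpace.exists_embedding_four hN Ω ε
  obtain ⟨c, hc0, hc⟩ := exists_le_quarticForm_self (ν := Ω.measure) hg
  exact palaisSmale_quarticEnergy (r := fun n => SystemSpace.riemannianGradient E (u n))
    (potentialForm_comm fun i => (ha2 i).toLp) (continuous_quarticForm g)
    (hasFDerivAt_quarticForm_self hsymm) hc0 hc hJc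
    (hE.trans (SystemSpace.energy_eq_quarticEnergy (fun i => (ha2 i).coeFn_toLp) hJ))
    (fun n => (hu n).2) hbdd
    (fun n ξ hξ => SystemSpace.inner_riemannianGradient E (u n) ξ hξ) hgrad
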